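/- Let $\widetilde S_n$ be the double cover of the symmetric group $S_n$, with generators $z,t_1,\dots,t_{n-1}$ and relations: $z$ central, $z^2=1$, $t_i^2=z$, $t_it_{i+1}t_i=t_{i+1}t_it_{i+1}$, $t_jt_i=z\,t_it_j$ for $|i-j|>1$; regard $\widetilde S_n\subset\widetilde S_{n+1}$ in the natural way. Put $x_i=t_it_{i+1}\cdots t_n\cdots t_{i+1}t_i\in\widetilde S_{n+1}$ for $1\le i\le n$, and for distinct $i_1,\dots,i_m\in\{1,\dots,n\}$, $m>1$, let $[i_1,\dots,i_m]=x_{i_1}x_{i_m}x_{i_{m-1}}\cdots x_{i_2}x_{i_1}\in\widetilde S_n$. Let $\mathcal{EP}$ be the set of partitions with only even parts. For $\lambda\in\mathcal{EP}$ of size $|\lambda|$ and length $\ell(\lambda)$ with $|\lambda|+\ell(\lambda)\le n$, let $D_\lambda(n)$ be the conjugacy class in $\widetilde S_n$ of $$t_\lambda=[1,\dots,\lambda_1+1]\,[\lambda_1+2,\dots,\lambda_1+\lambda_2+2]\cdots,$$ and let $d_\lambda(n)$ be the image of the sum of $D_\lambda(n)$ in the spin group algebra $\mathbb Z S_n^-=\mathbb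 Z\widetilde S_n/\langle z+1\rangle$; set $d_\lambda(n)=0$ if $|\lambda|+\ell(\lambda)>n$. For all $\lambda,\mu\in\mathcal{EP}$ and $n\ge 0$ there are unique integers $a_{\lambda\mu}^{\nu}(n)$, indexed by $\nu\in\mathcal{EP}$ with $|\nu|+\ell(\nu)\le n$, such that $d_\lambda(n)d_\mu(n)=\sum_\nu a_{\lambda\mu}^\nu(n)\,d_\nu(n)$; and if $|\nu|=|\lambda|+|\mu|$, then $a_{\lambda\mu}^\nu(n)$ has the same value $f_{\lambda\mu}^\nu$ for all $n\ge|\nu|+\ell(\nu)$. Let the graded spin FH-algebra $\mathcal F$ be the free $\mathbb Z$-module with basis $\{d_\lambda:\lambda\in\mathcal{EP}\}$ and bilinear product $$d_\lambda * d_\mu=\sum_{\nu\in\mathcal{EP},\ |\nu|=|\lambda|+|\mu|}f_{\lambda\mu}^\nu\,d_\nu .$$ **Theorem.** These structure constants are well defined in the sense just stated, and $\mathcal F$ is commutative and associative with unit $d_\emptyset$. Moreover $\mathbb Q\otimes_{\mathbb Z}\mathcal F$ is a polynomial algebra in the one-part classes $d_m=d_{(m)}$, $m=2,4,6,\dots$: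 there is a $\mathbb Q$-linear bijection from the polynomial ring $\mathbb Q[X_0,X_1,X_2,\dots]$ onto $\mathbb Q\otimes_{\mathbb Z}\mathcal F$ that preserves products, sends $1$ to $1\otimes d_\emptyset$, and sends $X_k$ to $1\otimes d_{2k+2}$ for every $k\ge0$. -/

import Mathlib

open scoped TensorProduct

noncomputable section

namespace SpinFH

/-! ### The double cover of the symmetric group

All indices start at `0`: `S_n` permutes `0, …, n - 1`, and `t_i` (for `i + 1 < n`) lies over the
transposition `(i, i + 1)`. -/

/-- The generators `z` and `t_i`, `i + 1 < n`. -/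
inductive Gen (n : ℕ) : Type
  | z : Gen n
  | t (i : ℕ) (h : i + 1 < n) : Gen n

/-- The relators of the double cover: each relation `a = b` is recorded as `a * b⁻¹`. -/
inductive IsRelator (n : ℕ) : FreeGroup (Gen n) → Prop
  | z_sq : IsRelator n (FreeGroup.of Gen.z * FreeGroup.of Gen.z)
  | z_central (i : ℕ) (h : i + 1 < n) : IsRelator n
      ((FreeGroup.of Gen.z * FreeGroup.of (Gen.t i h)) *
        (FreeGroup.of (Gen.t i h) * FreeGroup.of Gen.z)⁻¹)
  | t_sq (i : ℕ) (h : i + 1 < n) : IsRelator n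
      ((FreeGroup.of (Gen.t i h) * FreeGroup.of (Gen.t i h)) * (FreeGroup.of Gen.z)⁻¹)
  | braid (i : ℕ) (h : i + 1 < n) (h' : i + 1 + 1 < n) : IsRelator n
      ((FreeGroup.of (Gen.t i h) * FreeGroup.of (Gen.t (i + 1) h') * FreeGroup.of (Gen.t i h)) *
        (FreeGroup.of (Gen.t (i + 1) h') * FreeGroup.of (Gen.t i h) *
          FreeGroup.of (Gen.t (i + 1) h'))⁻¹)
  | far (i j : ℕ) (h : i + 1 < n) (h' : j + 1 < n) (hij : i + 1 < j ∨ j + 1 < i) : IsRelator n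
      ((FreeGroup.of (Gen.t j h') * FreeGroup.of (Gen.t i h)) *
        (FreeGroup.of Gen.z * FreeGroup.of (Gen.t i h) * FreeGroup.of (Gen.t j h'))⁻¹)

/-- The double cover of `S_n`: generators `z, t_i`; relations `z` central, `z² = 1`, `t_i² = z`,
`t_i t_{i+1} t_i = t_{i+1} t_i t_{i+1}`, and `t_j t_i = z t_i t_j` for `|i - j| > 1`. -/
abbrev Cover (n : ℕ) : Type := PresentedGroup {r : FreeGroup (Gen n) | IsRelator n r}

/-- The central element `z`. -/
def z (n : ℕ) : Cover n := PresentedGroup.of Gen.z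

/-- The generator `t_i` (with the unused value `1` when `i + 1 ≥ n`). -/
def t (n i : ℕ) : Cover n := if h : i + 1 < n then PresentedGroup.of (Gen.t i h) else 1

/-- The image of a generator in the next double cover. -/
def genSucc (n : ℕ) : Gen n → Cover (n + 1)
  | Gen.z => PresentedGroup.of Gen.z
  | Gen.t i h => PresentedGroup.of (Gen.t i (Nat.lt_succ_of_lt h))

theorem lift_genSucc_eq_one (n : ℕ) :
    ∀ r ∈ {r : FreeGroup (Gen n) | IsRelator n r}, FreeGroup.lift (genSucc n) r = 1 := by
  intro r hr
  have key : ∀ r' : FreeGroup (Gen (n + 1)), IsRelator (n + 1) r' →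
      PresentedGroup.mk {r : FreeGroup (Gen (n + 1)) | IsRelator (n + 1) r} r' = 1 :=
    fun r' h => PresentedGroup.one_of_mem h
  cases hr with
  | z_sq =>
    have := key _ IsRelator.z_sq
    simpa [genSucc, PresentedGroup.of] using this
  | z_central i h =>
    have := key _ (IsRelator.z_central i (Nat.lt_succ_of_lt h))
    simpa [genSucc, PresentedGroup.of] using this
  | t_sq i h =>
    have := key _ (IsRelator.t_sq i (Nat.lt_succ_of_lt h))
    simpa [genSucc, PresentedGroup.of] using this
  | braid i h h' =>
    have := key _ (IsRelator.braid i (Nat.lt_succ_of_lt h) (Nat.lt_succ_of_lt h'))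
    simpa [genSucc, PresentedGroup.of] using this
  | far i j h h' hij =>
    have := key _ (IsRelator.far i j (Nat.lt_succ_of_lt h) (Nat.lt_succ_of_lt h') hij)
    simpa [genSucc, PresentedGroup.of] using this

/-- The natural embedding of the double cover of `S_n` into that of `S_{n+1}`:
`z ↦ z`, `t_i ↦ t_i`. -/
def incl (n : ℕ) : Cover n →* Cover (n + 1) :=
  PresentedGroup.toGroup (lift_genSucc_eq_one n)

/-! ### Cycles and even split conjugacy classes -/

/-- `x_i = t_i t_{i+1} ⋯ t_{n-2} t_{n-1} t_{n-2} ⋯ t_{i+1} t_i` in the double cover of `S_{n+1}`,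
for `i < n`; it lies over the transposition `(i, n)`. -/
def x (n i : ℕ) : Cover (n + 1) :=
  ((List.range' i (n - 1 - i)).map (t (n + 1))).prod * t (n + 1) (n - 1) *
    ((List.range' i (n - 1 - i)).reverse.map (t (n + 1))).prod

/-- The cycle `[i_1, …, i_m]` on distinct points `i_1, …, i_m < n`: it is `z` for `m = 1`, and
`x_{i_1} x_{i_m} x_{i_{m-1}} ⋯ x_{i_2} x_{i_1}` for `m > 1`. It belongs to the copy of the double
cover of `S_n` inside the double cover of `S_{n+1}`. -/
def cycle (n : ℕ) : List ℕ → Cover (n + 1)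
  | [] => 1
  | [_] => z (n + 1)
  | i :: j :: l => x n i * ((j :: l).reverse.map (x n)).prod * x n i

/-- Partitions all of whose parts are even (and positive), as multisets of parts. -/
abbrev EvenPartition : Type := {s : Multiset ℕ // ∀ p ∈ s, 0 < p ∧ Even p}

/-- `|λ|`, the sum of the parts. -/
def EvenPartition.size (lam : EvenPartition) : ℕ := lam.1.sum

/-- `ℓ(λ)`, the number of parts. -/
def EvenPartition.length (lam : EvenPartition) : ℕ := Multiset.card lam.1

/-- The empty partition. -/
def EvenPartition.empty : EvenPartition := ⟨0, by simp⟩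

/-- The one-part partition `(2(k+1))`. -/
def EvenPartition.onePart (k : ℕ) : EvenPartition := ⟨{2 * (k + 1)}, by simp⟩

/-- The product of the cycles of lengths `p_1 + 1, p_2 + 1, …` on consecutive blocks of
consecutive points, the first block starting at `a`. -/
def blockCycles (n : ℕ) : ℕ → List ℕ → Cover (n + 1)
  | _, [] => 1
  | a, p :: ps => cycle n (List.range' a (p + 1)) * blockCycles n (a + (p + 1)) ps

/-- The distinguished element `t_λ` of modified type `λ`, for `|λ| + ℓ(λ) ≤ n`; the parts are
taken in non-increasing order. -/
def tElem (n : ℕ) (lam : EvenPartition) : Cover (n + 1) :=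
  blockCycles n 0 (lam.1.sort (· ≥ ·))

/-- `D_λ(n)`: the conjugacy class of `t_λ` in the double cover of `S_n` when
`|λ| + ℓ(λ) ≤ n`, and the empty set otherwise. -/
def D (n : ℕ) (lam : EvenPartition) : Set (Cover n) :=
  {g | lam.size + lam.length ≤ n ∧ ∃ g₀ : Cover n, incl n g₀ = tElem n lam ∧ IsConj g₀ g}

/-! ### The spin group algebra and its structure constants -/

/-- The two-sided ideal of the integral group algebra generated by `z + 1`. -/
def spinIdeal (n : ℕ) : TwoSidedIdeal (MonoidAlgebra ℤ (Cover n)) :=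
  TwoSidedIdeal.span {MonoidAlgebra.single (z n) 1 + 1}

/-- The integral spin group algebra `ℤ S_n⁻`. -/
abbrev SpinAlgebra (n : ℕ) : Type := (spinIdeal n).ringCon.Quotient

/-- `d_λ(n)`: the image in the spin group algebra of the class sum of `D_λ(n)`. -/
def classSum (n : ℕ) (lam : EvenPartition) : SpinAlgebra n :=
  (spinIdeal n).ringCon.mk' (∑ᶠ g ∈ D n lam, MonoidAlgebra.single g (1 : ℤ))

/-- `c` is a family of coefficients of the product `d_λ(n) d_μ(n)` with respect to the elements
`d_ν(n)`, `|ν| + ℓ(ν) ≤ n`. -/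
def IsExpansion (n : ℕ) (lam mu : EvenPartition) (c : EvenPartition →₀ ℤ) : Prop :=
  (∀ nu, c nu ≠ 0 → nu.size + nu.length ≤ n) ∧
    classSum n lam * classSum n mu = c.sum fun nu k => k • classSum n nu

open scoped Classical in
/-- The structure constants `a_{λμ}^ν(n)`:
`d_λ(n) d_μ(n) = ∑_ν a_{λμ}^ν(n) d_ν(n)`. -/
def structConst (n : ℕ) (lam mu nu : EvenPartition) : ℤ :=
  if h : ∃ c, IsExpansion n lam mu c then h.choose nu else 0

/-- The coefficient `f_{λμ}^ν` for `|ν| = |λ| + |μ|`: the common value of `a_{λμ}^ν(n)` for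
`n ≥ |ν| + ℓ(ν)`, read off at the least such `n`. -/
def topConst (lam mu nu : EvenPartition) : ℤ :=
  structConst (nu.size + nu.length) lam mu nu

/-! ### The graded spin FH-algebra -/

/-- The underlying free abelian group of the graded spin FH-algebra, with basis `d_λ`. -/
def FH : Type := EvenPartition →₀ ℤ

instance : AddCommGroup FH := inferInstanceAs (AddCommGroup (EvenPartition →₀ ℤ))

/-- The basis element `d_λ`. -/
def FH.d (lam : EvenPartition) : FH := Finsupp.single lam (1 : ℤ)

/-- The product of two basis elements: `d_λ * d_μ = ∑_{|ν| = |λ| + |μ|} f_{λμ}^ν d_ν`. -/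
def FH.basisMul (lam mu : EvenPartition) : FH :=
  ∑ p : {p : Nat.Partition (lam.size + mu.size) // ∀ i ∈ p.parts, Even i},
    topConst lam mu ⟨p.1.parts, fun i hi => ⟨p.1.parts_pos hi, p.2 i hi⟩⟩ •
      FH.d ⟨p.1.parts, fun i hi => ⟨p.1.parts_pos hi, p.2 i hi⟩⟩

/-- The bilinear extension of `FH.basisMul`. -/
def FH.mul (a b : FH) : FH :=
  Finsupp.sum (show EvenPartition →₀ ℤ from a) fun lam k =>
    Finsupp.sum (show EvenPartition →₀ ℤ from b) fun mu l => (k * l) • FH.basisMul lam mu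

theorem FH.mul_add' (a b c : FH) : FH.mul a (b + c) = FH.mul a b + FH.mul a c := by
  unfold FH.mul
  refine Eq.trans ?_ Finsupp.sum_add
  refine Finsupp.sum_congr fun lam _ => ?_
  exact Finsupp.sum_add_index' (fun mu => by simp) (fun mu k l => by rw [mul_add, add_smul])

theorem FH.add_mul' (a b c : FH) : FH.mul (a + b) c = FH.mul a c + FH.mul b c := by
  unfold FH.mul
  refine Finsupp.sum_add_index' (fun lam => by simp [Finsupp.sum]) (fun lam k l => ?_)
  refine Eq.trans ?_ Finsupp.sum_add
  exact Finsupp.sum_congr fun mu _ => by rw [add_mul, add_smul]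

/-- The graded spin FH-algebra `F` with its bilinear product. Commutativity, associativity and the
unit law are not built in. -/
instance : NonUnitalNonAssocRing FH :=
  { (inferInstance : AddCommGroup FH) with
    mul := FH.mul
    left_distrib := FH.mul_add'
    right_distrib := FH.add_mul'
    zero_mul := fun a => by
      have h : FH.mul (0 + 0) a = FH.mul 0 a + FH.mul 0 a := FH.add_mul' 0 0 a
      change FH.mul 0 a = 0
      simpa using h
    mul_zero := fun a => by
      have h : FH.mul a (0 + 0) = FH.mul a 0 + FH.mul a 0 := FH.mul_add' a 0 0
      change FH.mul a 0 = 0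
      simpa using h }

end SpinFH

end

/-! The projection of the double cover onto $S_n$ has kernel exactly $\{1,z\}$: words in the $t_i$
reduce to normal forms along the chain of inclusions, and $z\ne1$ because $z$ acts as $-1$ in a
Clifford algebra. Consequently a permutation of odd order has exactly one lift of odd order, and
this lift is a canonical choice of sign compatible with conjugation and with the inclusions.

The spin group algebra is the space of functions with $f(zg)=-f(g)$ (`spinMk_eq_iff`). Lifts of
disjoint odd permutations anticommute (`mul_comm_of_disjoint`), so an antisymmetric class function
supported over even permutations vanishes over any permutation with a cycle of even length. What
remains is spanned by the sums of the odd-order classes (`exists_expansion`). Each $d_\lambda(n)$ is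
such a sum up to a sign independent of $n$ (`classSum_eq`, `odd_orderOf_tElem`), so expansions exist
and are unique.

The size $|\lambda|$ is the codimension of the fixed space of a permutation of modified type
$\lambda$, hence subadditive under products. If $|\nu|=|\lambda|+|\mu|$, a factorisation $w=uv$ has
$\mathrm{Fix}(w)=\mathrm{Fix}(u)\cap\mathrm{Fix}(v)$, so $u$ and $v$ fix every point fixed by $w$.
This makes the top coefficients independent of $n$ (`antisym_mul_incl`). Associativity is then
inherited from the spin algebra of one large $n$ (`FH.coef_mul_mul`).

For the same reason $\ell(\nu)\le\ell(\lambda)+\ell(\mu)$ in top degree. Equality forces disjoint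
factors and $\nu=\lambda\cup\mu$; the corresponding coefficient is nonzero because all contributions
carry the same sign (`antisym_mul_pos`). Products of one-part classes are therefore triangular in
the basis $d_\lambda$ with respect to length, with nonzero diagonal, which gives the polynomial
algebra over $\mathbb Q$. -/

noncomputable section

namespace SpinFH

/-! ### The double cover as a central extension of the symmetric group -/

section Lift

variable {H : Type*} [Group H] (n : ℕ) (ζ : H) (τ : ℕ → H)

/-- The values on generators of a homomorphism out of the double cover. -/
def genMap : Gen n → H
  | Gen.z => ζ
  | Gen.t i _ => τ i

theorem lift_genMap_eq_one (hz : ζ * ζ = 1)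
    (hc : ∀ i, i + 1 < n → ζ * τ i = τ i * ζ)
    (hs : ∀ i, i + 1 < n → τ i * τ i = ζ)
    (hb : ∀ i, i + 1 + 1 < n → τ i * τ (i + 1) * τ i = τ (i + 1) * τ i * τ (i + 1))
    (hf : ∀ i j, i + 1 < n → j + 1 < n → (i + 1 < j ∨ j + 1 < i) →
      τ j * τ i = ζ * τ i * τ j) :
    ∀ r ∈ {r : FreeGroup (Gen n) | IsRelator n r}, FreeGroup.lift (genMap n ζ τ) r = 1 := by
  intro r hr
  cases hr with
  | z_sq => simpa [genMap] using hz
  | z_central i h => simpa [genMap, mul_inv_eq_one, mul_assoc] using mul_inv_eq_one.2 (hc i h)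
  | t_sq i h => simpa [genMap] using mul_inv_eq_one.2 (hs i h)
  | braid i h h' => simpa [genMap, mul_assoc] using mul_inv_eq_one.2 (hb i h')
  | far i j h h' hij => simpa [genMap, mul_assoc] using mul_inv_eq_one.2 (hf i j h h' hij)

end Lift

theorem z_mul_z (n : ℕ) : z n * z n = 1 := by
  have := PresentedGroup.one_of_mem (rels := {r : FreeGroup (Gen n) | IsRelator n r})
    (IsRelator.z_sq (n := n))
  simpa [z, PresentedGroup.of] using this

theorem t_eq_of {n i : ℕ} (h : i + 1 < n) : t n i = PresentedGroup.of (Gen.t i h) := dif_pos h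

theorem z_mul_t (n i : ℕ) : z n * t n i = t n i * z n := by
  by_cases h : i + 1 < n
  · have := PresentedGroup.one_of_mem (rels := {r : FreeGroup (Gen n) | IsRelator n r})
      (IsRelator.z_central (n := n) i h)
    rw [map_mul, map_inv, mul_inv_eq_one] at this
    simpa [t_eq_of h, z, PresentedGroup.of] using this
  · simp [t, h]

theorem t_mul_t {n i : ℕ} (h : i + 1 < n) : t n i * t n i = z n := by
  have := PresentedGroup.one_of_mem (rels := {r : FreeGroup (Gen n) | IsRelator n r})
    (IsRelator.t_sq (n := n) i h)
  rw [map_mul, map_inv, mul_inv_eq_one] at this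
  simpa [t_eq_of h, z, PresentedGroup.of] using this

theorem t_braid {n i : ℕ} (h : i + 1 + 1 < n) :
    t n i * t n (i + 1) * t n i = t n (i + 1) * t n i * t n (i + 1) := by
  have h' : i + 1 < n := by omega
  have := PresentedGroup.one_of_mem (rels := {r : FreeGroup (Gen n) | IsRelator n r})
    (IsRelator.braid (n := n) i h' h)
  rw [map_mul, map_inv, mul_inv_eq_one] at this
  simpa [t_eq_of h, t_eq_of h', z, PresentedGroup.of] using this

theorem t_far {n i j : ℕ} (h : i + 1 < n) (h' : j + 1 < n) (hij : i + 1 < j ∨ j + 1 < i) :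
    t n j * t n i = z n * t n i * t n j := by
  have := PresentedGroup.one_of_mem (rels := {r : FreeGroup (Gen n) | IsRelator n r})
    (IsRelator.far (n := n) i j h h' hij)
  rw [map_mul, map_inv, mul_inv_eq_one] at this
  simpa [t_eq_of h, t_eq_of h', z, PresentedGroup.of] using this

/-- A subgroup containing `z` and all `t_i` is everything. -/
theorem mem_of_generators {n : ℕ} (K : Subgroup (Cover n)) (hz : z n ∈ K)
    (ht : ∀ i, i + 1 < n → t n i ∈ K) (g : Cover n) : g ∈ K := by
  refine PresentedGroup.generated_by _ K (fun j => ?_) g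
  cases j with
  | z => exact hz
  | t i h => rw [← t_eq_of h]; exact ht i h

theorem z_comm {n : ℕ} (g : Cover n) : z n * g = g * z n := by
  have h := mem_of_generators (Subgroup.centralizer {z n})
    (by simp [Subgroup.mem_centralizer_iff])
    (fun i _ => by simp [Subgroup.mem_centralizer_iff, z_mul_t]) g
  simpa [Subgroup.mem_centralizer_iff] using h

theorem z_inv (n : ℕ) : (z n)⁻¹ = z n := inv_eq_of_mul_eq_one_left (z_mul_z n)

theorem z_mul_z_mul {n : ℕ} (g : Cover n) : z n * (z n * g) = g := by
  rw [← mul_assoc, z_mul_z, one_mul]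

theorem cover_hom_ext {H : Type*} [Group H] {n : ℕ} {φ ψ : Cover n →* H} (hz : φ (z n) = ψ (z n))
    (ht : ∀ i, i + 1 < n → φ (t n i) = ψ (t n i)) : φ = ψ := by
  refine PresentedGroup.ext fun j => ?_
  cases j with
  | z => exact hz
  | t i h => rw [← t_eq_of h]; exact ht i h

@[simp] theorem incl_z (n : ℕ) : incl n (z n) = z (n + 1) := by
  simp [incl, z, genSucc]

theorem incl_t {n i : ℕ} (h : i + 1 < n) : incl n (t n i) = t (n + 1) i := by
  rw [t_eq_of h, t_eq_of (Nat.lt_succ_of_lt h)]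
  simp [incl, genSucc]

/-! ### The projection to the symmetric group -/

/-- The transposition `(i, i + 1)` of `Fin n`, or `1` if `i + 1 ≥ n`. -/
def adjSwap (n i : ℕ) : Equiv.Perm (Fin n) :=
  if h : i + 1 < n then Equiv.swap ⟨i, by omega⟩ ⟨i + 1, h⟩ else 1

theorem swap_braid {α : Type*} [DecidableEq α] {a b c : α} (hab : a ≠ b) (hbc : b ≠ c)
    (hac : a ≠ c) : Equiv.swap a b * Equiv.swap b c * Equiv.swap a b =
      Equiv.swap b c * Equiv.swap a b * Equiv.swap b c := by
  rw [Equiv.swap_mul_swap_mul_swap hab hac, Equiv.swap_comm a b, Equiv.swap_comm b c,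
    Equiv.swap_mul_swap_mul_swap hbc.symm hac.symm, Equiv.swap_comm]

/-- The projection of the double cover onto the symmetric group. -/
def proj (n : ℕ) : Cover n →* Equiv.Perm (Fin n) :=
  PresentedGroup.toGroup (f := genMap n 1 (adjSwap n)) (lift_genMap_eq_one n 1 (adjSwap n)
    (by simp) (by simp) (fun i h => by simp [adjSwap, h])
    (fun i h => by
      have h' : i + 1 < n := by omega
      simp only [adjSwap, h, h', dif_pos]
      exact swap_braid (by simp) (by simp) (by simp [add_assoc]))
    (fun i j h h' hij => by
      simp only [adjSwap, h, h', dif_pos, one_mul]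
      refine (Equiv.Perm.Disjoint.commute ?_).eq
      rw [Equiv.Perm.disjoint_iff_disjoint_support, Equiv.Perm.support_swap (by simp),
        Equiv.Perm.support_swap (by simp)]
      simp only [Finset.disjoint_insert_right, Finset.disjoint_singleton_right, Finset.mem_insert,
        Finset.mem_singleton, Fin.mk.injEq]
      omega))

@[simp] theorem proj_z (n : ℕ) : proj n (z n) = 1 := by simp [proj, z, genMap]

theorem proj_t {n i : ℕ} (h : i + 1 < n) : proj n (t n i) = adjSwap n i := by
  rw [t_eq_of h]; simp [proj, genMap]

/-- The embedding of symmetric groups adding a fixed last point. -/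
def emb (n : ℕ) : Equiv.Perm (Fin n) →* Equiv.Perm (Fin (n + 1)) :=
  Equiv.Perm.extendDomainHom (finSuccAboveEquiv (Fin.last n))

theorem emb_castSucc {n : ℕ} (w : Equiv.Perm (Fin n)) (a : Fin n) :
    emb n w a.castSucc = (w a).castSucc := by
  have := Equiv.Perm.extendDomain_apply_image w (finSuccAboveEquiv (Fin.last n)) a
  simpa [emb, finSuccAboveEquiv_apply, Equiv.Perm.extendDomainHom] using this

theorem emb_last {n : ℕ} (w : Equiv.Perm (Fin n)) : emb n w (Fin.last n) = Fin.last n :=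
  Equiv.Perm.extendDomain_apply_not_subtype _ _ (by simp)

theorem emb_injective (n : ℕ) : Function.Injective (emb n) :=
  Equiv.Perm.extendDomainHom_injective _

theorem cycleType_emb {n : ℕ} (w : Equiv.Perm (Fin n)) : (emb n w).cycleType = w.cycleType :=
  Equiv.Perm.cycleType_extendDomain _

theorem adjSwap_eq {n i : ℕ} (h : i + 1 < n) :
    adjSwap n i = Equiv.swap ⟨i, by omega⟩ ⟨i + 1, h⟩ := dif_pos h

theorem emb_swap {n : ℕ} (a b : Fin n) :
    emb n (Equiv.swap a b) = Equiv.swap a.castSucc b.castSucc := by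
  ext x
  refine Fin.lastCases ?_ (fun x => ?_) x
  · rw [emb_last, Equiv.swap_apply_of_ne_of_ne (Fin.castSucc_lt_last a).ne'
      (Fin.castSucc_lt_last b).ne']
  · rw [emb_castSucc, (Fin.castSucc_injective n).swap_apply]

theorem proj_incl {n : ℕ} (g : Cover n) : proj (n + 1) (incl n g) = emb n (proj n g) := by
  have : (proj (n + 1)).comp (incl n) = (emb n).comp (proj n) := by
    refine cover_hom_ext (by simp) (fun i h => ?_)
    simp only [MonoidHom.comp_apply]
    rw [incl_t h, proj_t h, proj_t (by omega), adjSwap_eq h, adjSwap_eq (by omega), emb_swap]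
    rfl
  exact DFunLike.congr_fun this g

theorem proj_surjective (n : ℕ) : Function.Surjective (proj n) := by
  cases n with
  | zero => exact fun w => ⟨1, Subsingleton.elim _ _⟩
  | succ n =>
    have key : Submonoid.closure (Set.range fun i : Fin n => Equiv.swap i.castSucc i.succ) ≤
        (proj (n + 1)).range.toSubmonoid := by
      rw [Submonoid.closure_le]
      rintro _ ⟨i, rfl⟩
      refine ⟨t (n + 1) i, ?_⟩
      rw [proj_t (by omega), adjSwap_eq (by omega)]
      rfl
    intro w
    exact key (Equiv.Perm.mclosure_swap_castSucc_succ n ▸ Submonoid.mem_top w)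

/-! ### Nontriviality of `z` -/

/-- The quadratic form `-½ ∑ v_i²`, for which `e_i - e_{i+1}` has square `-1`. -/
def halfForm (n : ℕ) : QuadraticForm ℚ (Fin n → ℚ) :=
  QuadraticMap.weightedSumSquares ℚ fun _ : Fin n => (-1 / 2 : ℚ)

/-- The simple root `e_i - e_{i+1}`. -/
def simpleRoot (n i : ℕ) : Fin n → ℚ :=
  fun a => (if a.val = i then 1 else 0) - (if a.val = i + 1 then 1 else 0)

theorem halfForm_apply (n : ℕ) (v : Fin n → ℚ) : halfForm n v = -1 / 2 * ∑ a, v a * v a := by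
  simp [halfForm, QuadraticMap.weightedSumSquares_apply, Finset.mul_sum]

theorem sum_simpleRoot_mul {n i : ℕ} (h : i + 1 < n) (v : Fin n → ℚ) :
    ∑ a, simpleRoot n i a * v a = v ⟨i, by omega⟩ - v ⟨i + 1, h⟩ := by
  have key : ∀ (j : ℕ) (hj : j < n), ∑ a : Fin n, (if a.val = j then (1 : ℚ) else 0) * v a =
      v ⟨j, hj⟩ := by
    intro j hj
    rw [Finset.sum_eq_single ⟨j, hj⟩]
    · simp
    · intro b _ hb
      rw [if_neg (fun h' => hb (Fin.ext h')), zero_mul]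
    · simp
  simp only [simpleRoot, sub_mul, Finset.sum_sub_distrib]
  rw [key i (by omega), key (i + 1) h]

theorem halfForm_simpleRoot {n i : ℕ} (h : i + 1 < n) : halfForm n (simpleRoot n i) = -1 := by
  rw [halfForm_apply, sum_simpleRoot_mul h]
  simp [simpleRoot]
  norm_num

theorem polar_simpleRoot {n i : ℕ} (h : i + 1 < n) (j : ℕ) :
    QuadraticMap.polar (halfForm n) (simpleRoot n i) (simpleRoot n j) =
      -(simpleRoot n j ⟨i, by omega⟩ - simpleRoot n j ⟨i + 1, h⟩) := by
  rw [← sum_simpleRoot_mul h]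
  simp only [QuadraticMap.polar, halfForm_apply, Pi.add_apply, Finset.mul_sum,
    ← Finset.sum_sub_distrib, ← Finset.sum_neg_distrib]
  refine Finset.sum_congr rfl fun a _ => ?_
  ring

/-- The image of `t_i` in the Clifford algebra. -/
def cliffordT (n i : ℕ) : CliffordAlgebra (halfForm n) :=
  CliffordAlgebra.ι (halfForm n) (simpleRoot n i)

theorem cliffordT_sq {n i : ℕ} (h : i + 1 < n) : cliffordT n i * cliffordT n i = -1 := by
  rw [cliffordT, CliffordAlgebra.ι_sq_scalar, halfForm_simpleRoot h]
  simp

theorem cliffordT_swap {n i : ℕ} (h : i + 1 < n) (j : ℕ) :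
    cliffordT n i * cliffordT n j + cliffordT n j * cliffordT n i =
      algebraMap ℚ _ (-(simpleRoot n j ⟨i, by omega⟩ - simpleRoot n j ⟨i + 1, h⟩)) := by
  rw [← polar_simpleRoot h]
  exact CliffordAlgebra.ι_mul_ι_add_swap _ _

/-- The unit of the Clifford algebra underlying `cliffordT`. -/
def cliffordUnit (n i : ℕ) : (CliffordAlgebra (halfForm n))ˣ :=
  if h : i + 1 < n then
    ⟨cliffordT n i, -cliffordT n i, by simp [cliffordT_sq h], by simp [cliffordT_sq h]⟩
  else 1

theorem cliffordUnit_val {n i : ℕ} (h : i + 1 < n) :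
    (cliffordUnit n i : CliffordAlgebra (halfForm n)) = cliffordT n i := by
  simp [cliffordUnit, h]

/-- From $uv+vu=1$ and $u^2=v^2=-1$, both triple products equal $u+v$. -/
theorem clifford_braid {n i : ℕ} (h : i + 1 + 1 < n) :
    cliffordT n i * cliffordT n (i + 1) * cliffordT n i =
      cliffordT n (i + 1) * cliffordT n i * cliffordT n (i + 1) := by
  have h' : i + 1 < n := by omega
  have e : cliffordT n i * cliffordT n (i + 1) + cliffordT n (i + 1) * cliffordT n i = 1 := by
    rw [cliffordT_swap h']
    have : ¬ i = i + 1 + 1 := by omega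
    simp [simpleRoot, this]
  have s1 := cliffordT_sq h'
  have s2 := cliffordT_sq h
  set u := cliffordT n i
  set v := cliffordT n (i + 1)
  have e1 : u * v = 1 - v * u := eq_sub_of_add_eq e
  have e2 : v * u = 1 - u * v := eq_sub_of_add_eq' e
  have a1 : u * v * u = u + v := by
    rw [e1, sub_mul, mul_assoc, s1]; simp
  have a2 : v * u * v = u + v := by
    rw [e2, sub_mul, mul_assoc, s2]; simp [add_comm]
  rw [a1, a2]

/-- The spin representation: a homomorphism to the units of a Clifford algebra. -/
def cliffordHom (n : ℕ) : Cover n →* (CliffordAlgebra (halfForm n))ˣ :=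
  PresentedGroup.toGroup (f := genMap n (-1) (cliffordUnit n))
    (lift_genMap_eq_one n (-1) (cliffordUnit n)
    (by simp) (fun i _ => by simp)
    (fun i h => Units.ext (by simp [cliffordUnit_val h, cliffordT_sq h]))
    (fun i h => Units.ext (by
      have h' : i + 1 < n := by omega
      simpa [cliffordUnit_val h, cliffordUnit_val h'] using clifford_braid h))
    (fun i j h h' hij => Units.ext (by
      have e := cliffordT_swap h' i
      have e2 : simpleRoot n i ⟨j, by omega⟩ - simpleRoot n i ⟨j + 1, h'⟩ = 0 := by
        simp only [simpleRoot]
        rw [if_neg (by omega), if_neg (by omega), if_neg (by omega), if_neg (by omega)]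
        simp
      rw [e2] at e
      have e3 := eq_neg_of_add_eq_zero_left (by simpa using e)
      simpa [cliffordUnit_val h, cliffordUnit_val h'] using e3)))

/-- The spin representation sends $z$ to $-1$, which differs from $1$ because $\mathbb Q$ embeds in
the Clifford algebra. -/
theorem z_ne_one (n : ℕ) : z n ≠ 1 := by
  intro h
  have h1 : cliffordHom n (z n) = -1 := by simp [cliffordHom, z, genMap]
  rw [h, map_one] at h1
  have h2 := congrArg Units.val h1
  have h3 : (algebraMap ℚ (CliffordAlgebra (halfForm n))) 1 = algebraMap ℚ _ (-1) := by
    simpa using h2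
  have h4 := (algebraMap ℚ (CliffordAlgebra (halfForm n))).injective h3
  norm_num at h4

/-! ### The kernel of the projection -/

/-- The descending products `t_{n-1} t_{n-2} ⋯ t_{n-k}` in the double cover of `S_{n+1}`. -/
def descProd (n : ℕ) : ℕ → Cover (n + 1)
  | 0 => 1
  | k + 1 => descProd n k * t (n + 1) (n - 1 - k)

theorem z_mem_range_incl (n : ℕ) : z (n + 1) ∈ (incl n).range := ⟨z n, incl_z n⟩

theorem t_mem_range_incl {n i : ℕ} (h : i + 1 < n) : t (n + 1) i ∈ (incl n).range :=
  ⟨t n i, incl_t h⟩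

/-- Here $t_i$ is far from every factor of the descending product, so it passes to the left at the
cost of powers of $z$. -/
theorem descProd_mul_t_of_lt {n : ℕ} (k i : ℕ) (h : i + 1 + k < n) :
    ∃ g ∈ (incl n).range, descProd n k * t (n + 1) i = g * descProd n k := by
  induction k with
  | zero => exact ⟨t (n + 1) i, t_mem_range_incl (by omega), by simp [descProd]⟩
  | succ k ih =>
    obtain ⟨g, hg, e⟩ := ih (by omega)
    refine ⟨z (n + 1) * g, mul_mem (z_mem_range_incl n) hg, ?_⟩
    rw [descProd, mul_assoc, t_far (by omega) (by omega) (Or.inl (by omega)), mul_assoc (z (n + 1)),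
      ← mul_assoc, ← z_comm, mul_assoc, ← mul_assoc (descProd n k), e]
    simp only [mul_assoc]

/-- Moving left, $t_i$ meets the factors $t_i t_{i-1}$; the braid relation turns $t_i t_{i-1}t_i$
into $t_{i-1}t_it_{i-1}$, and the new $t_{i-1}$ is far from all remaining factors. -/
theorem descProd_mul_t_of_gt {n : ℕ} (k i : ℕ) (hk : k ≤ n) (h : n < i + k) (hi : i < n) :
    ∃ g ∈ (incl n).range, descProd n k * t (n + 1) i = g * descProd n k := by
  induction k with
  | zero => omega
  | succ k ih =>
    by_cases h' : n < i + k
    · obtain ⟨g, hg, e⟩ := ih (by omega) h'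
      refine ⟨z (n + 1) * g, mul_mem (z_mem_range_incl n) hg, ?_⟩
      rw [descProd, mul_assoc, t_far (by omega) (by omega) (Or.inr (by omega)),
        mul_assoc (z (n + 1)), ← mul_assoc, ← z_comm, mul_assoc, ← mul_assoc (descProd n k), e]
      simp only [mul_assoc]
    · obtain ⟨m, rfl⟩ : ∃ m, k = m + 1 := ⟨k - 1, by omega⟩
      obtain ⟨j, rfl⟩ : ∃ j, i = j + 1 := ⟨i - 1, by omega⟩
      obtain ⟨g, hg, e⟩ := descProd_mul_t_of_lt (n := n) m j (by omega)
      refine ⟨g, hg, ?_⟩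
      have e1 : n - 1 - m = j + 1 := by omega
      have e2 : n - 1 - (m + 1) = j := by omega
      rw [descProd, descProd, e1, e2]
      calc descProd n m * t (n + 1) (j + 1) * t (n + 1) j * t (n + 1) (j + 1)
          = descProd n m * (t (n + 1) (j + 1) * t (n + 1) j * t (n + 1) (j + 1)) := by
            simp only [mul_assoc]
        _ = descProd n m * t (n + 1) j * t (n + 1) (j + 1) * t (n + 1) j := by
            rw [← t_braid (by omega)]; simp only [mul_assoc]
        _ = _ := by rw [e]; simp only [mul_assoc]

/-- The descending products represent the right cosets of the smaller cover. A generator on the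
right fixes the coset, lengthens the product by one factor, or cancels its last factor into $z$. -/
theorem descProd_mul_t {n : ℕ} (k i : ℕ) (hk : k ≤ n) (hi : i < n) :
    ∃ g ∈ (incl n).range, ∃ k' ≤ n, descProd n k * t (n + 1) i = g * descProd n k' := by
  rcases lt_trichotomy (i + 1 + k) n with h | h | h
  · obtain ⟨g, hg, e⟩ := descProd_mul_t_of_lt k i h
    exact ⟨g, hg, k, hk, e⟩
  · refine ⟨1, one_mem _, k + 1, by omega, ?_⟩
    rw [one_mul, descProd, show n - 1 - k = i by omega]
  · by_cases h' : n < i + k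
    · obtain ⟨g, hg, e⟩ := descProd_mul_t_of_gt k i hk h' hi
      exact ⟨g, hg, k, hk, e⟩
    · obtain ⟨m, rfl⟩ : ∃ m, k = m + 1 := ⟨k - 1, by omega⟩
      refine ⟨z (n + 1), z_mem_range_incl n, m, by omega, ?_⟩
      rw [descProd, show n - 1 - m = i by omega, mul_assoc, t_mul_t (by omega), z_comm]

theorem exists_eq_incl_mul_descProd {n : ℕ} (g : Cover (n + 1)) :
    ∃ h ∈ (incl n).range, ∃ k ≤ n, g = h * descProd n k := by
  let S : Set (Cover (n + 1)) := {g | ∃ h ∈ (incl n).range, ∃ k ≤ n, g = h * descProd n k}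
  have step : ∀ a ∈ S, ∀ i, i < n → a * t (n + 1) i ∈ S := by
    rintro _ ⟨h, hh, k, hk, rfl⟩ i hi
    obtain ⟨g, hg, k', hk', e⟩ := descProd_mul_t k i hk hi
    exact ⟨h * g, mul_mem hh hg, k', hk', by rw [mul_assoc, e, mul_assoc]⟩
  have stepz : ∀ a ∈ S, a * z (n + 1) ∈ S := by
    rintro _ ⟨h, hh, k, hk, rfl⟩
    exact ⟨z (n + 1) * h, mul_mem (z_mem_range_incl n) hh, k, hk, by
      rw [← z_comm, mul_assoc]⟩
  -- `K` is the set of elements that, together with their inverses, preserve `S` under right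
  -- multiplication. It contains the generators, so it is everything, and `S` contains $1$.
  let K : Subgroup (Cover (n + 1)) :=
    { carrier := {b | ∀ a ∈ S, a * b ∈ S ∧ a * b⁻¹ ∈ S}
      one_mem' := by simp
      mul_mem' := by
        intro b c hb hc a ha
        rw [mul_inv_rev, ← mul_assoc, ← mul_assoc]
        exact ⟨(hc _ (hb a ha).1).1, (hb _ (hc a ha).2).2⟩
      inv_mem' := by
        intro b hb a ha
        rw [inv_inv]
        exact (hb a ha).symm }
  have hK := mem_of_generators K (fun a ha => by
      rw [z_inv]; exact ⟨stepz a ha, stepz a ha⟩)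
    (fun i hi a ha => by
      refine ⟨step a ha i (by omega), ?_⟩
      have e : (t (n + 1) i)⁻¹ = t (n + 1) i * z (n + 1) := by
        rw [inv_eq_iff_mul_eq_one, ← mul_assoc, t_mul_t hi, z_mul_z]
      rw [e, ← mul_assoc]
      exact stepz _ (step a ha i (by omega))) g
  have := (hK 1 ⟨1, one_mem _, 0, by omega, by simp [descProd]⟩).1
  simpa [S] using this

theorem proj_descProd_apply {n : ℕ} (k : ℕ) (hk : k ≤ n) :
    proj (n + 1) (descProd n k) ⟨n - k, by omega⟩ = Fin.last n := by
  induction k with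
  | zero => simp [descProd, Fin.last]
  | succ k ih =>
    rw [descProd, map_mul, proj_t (by omega), adjSwap_eq (by omega), Equiv.Perm.mul_apply]
    have e : (⟨n - (k + 1), by omega⟩ : Fin (n + 1)) = ⟨n - 1 - k, by omega⟩ :=
      Fin.ext (by simp; omega)
    rw [e, Equiv.swap_apply_left, ← ih (by omega)]
    congr 1
    exact Fin.ext (by simp; omega)

/-- The representative with $k$ factors sends the point $n-k$ to the last point, and the smaller
cover fixes the last point, so fixing it forces $k=0$. -/
theorem mem_range_incl {n : ℕ} {g : Cover (n + 1)}
    (hg : proj (n + 1) g (Fin.last n) = Fin.last n) : g ∈ (incl n).range := by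
  obtain ⟨_, ⟨h, rfl⟩, k, hk, rfl⟩ := exists_eq_incl_mul_descProd g
  have h1 := proj_descProd_apply k hk
  have h2 : proj (n + 1) (incl n h * descProd n k) ⟨n - k, by omega⟩ = Fin.last n := by
    rw [map_mul, Equiv.Perm.mul_apply, h1, proj_incl, emb_last]
  have h3 := (proj (n + 1) (incl n h * descProd n k)).injective (h2.trans hg.symm)
  have h4 : k = 0 := by
    have := congrArg Fin.val h3
    simp at this
    omega
  subst h4
  simp [descProd]

/-- A kernel element fixes the last point, so it comes from the smaller cover, where it again lies
in the kernel. -/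
theorem eq_one_or_eq_z_of_proj_eq_one {n : ℕ} {g : Cover n} (hg : proj n g = 1) :
    g = 1 ∨ g = z n := by
  induction n with
  | zero =>
    -- For $n=0$ there are no $t_i$: the cover is generated by $z$.
    refine Subgroup.mem_zpowers_iff.1 (mem_of_generators (Subgroup.zpowers (z 0))
      (Subgroup.mem_zpowers _) (by simp) g) |>.elim fun k hk => ?_
    rw [← hk]
    rcases Int.even_or_odd' k with ⟨m, rfl | rfl⟩
    · left; rw [zpow_mul, zpow_ofNat, pow_two, z_mul_z, one_zpow]
    · right; rw [zpow_add, zpow_mul, zpow_ofNat, pow_two, z_mul_z, one_zpow, one_mul, zpow_one]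
  | succ n ih =>
    obtain ⟨h, rfl⟩ := mem_range_incl (g := g) (by rw [hg]; rfl)
    rw [proj_incl] at hg
    rcases ih (emb_injective n (hg.trans (map_one _).symm)) with rfl | rfl
    · exact Or.inl (map_one _)
    · exact Or.inr (incl_z n)

theorem eq_or_eq_z_mul {n : ℕ} {g h : Cover n} (e : proj n g = proj n h) :
    g = h ∨ g = z n * h := by
  have : proj n (g * h⁻¹) = 1 := by rw [map_mul, map_inv, e, mul_inv_cancel]
  rcases eq_one_or_eq_z_of_proj_eq_one this with h | h
  · exact Or.inl (mul_inv_eq_one.1 h)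
  · exact Or.inr (mul_inv_eq_iff_eq_mul.1 h)

theorem z_mul_ne {n : ℕ} (g : Cover n) : z n * g ≠ g := fun h =>
  z_ne_one n (mul_eq_right.1 h)

theorem proj_z_mul {n : ℕ} (g : Cover n) : proj n (z n * g) = proj n g := by simp

theorem incl_injective (n : ℕ) : Function.Injective (incl n) := by
  rw [injective_iff_map_eq_one]
  intro g hg
  have h1 : emb n (proj n g) = 1 := by rw [← proj_incl, hg, map_one]
  rcases eq_one_or_eq_z_of_proj_eq_one (emb_injective n (h1.trans (map_one _).symm)) with h | h
  · exact h
  · rw [h, incl_z] at hg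
    exact absurd hg (z_ne_one _)

/-- A set-theoretic section of the projection. -/
def sec (n : ℕ) (w : Equiv.Perm (Fin n)) : Cover n := (proj_surjective n w).choose

theorem proj_sec {n : ℕ} (w : Equiv.Perm (Fin n)) : proj n (sec n w) = w :=
  (proj_surjective n w).choose_spec

instance (n : ℕ) : Finite (Cover n) := by
  refine Finite.of_surjective
    (fun p : Equiv.Perm (Fin n) × Bool => if p.2 then sec n p.1 else z n * sec n p.1) fun g => ?_
  rcases eq_or_eq_z_mul (proj_sec (proj n g)).symm with h | h
  · exact ⟨(proj n g, true), by simpa using h.symm⟩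
  · exact ⟨(proj n g, false), by simpa using h.symm⟩

instance (n : ℕ) : Fintype (Cover n) := Fintype.ofFinite _

/-! ### Lifts of odd order -/

theorem z_mul_pow {n : ℕ} (g : Cover n) (k : ℕ) : (z n * g) ^ k = z n ^ k * g ^ k :=
  Commute.mul_pow (z_comm g) k

theorem z_pow_of_odd {n k : ℕ} (hk : Odd k) : z n ^ k = z n := by
  obtain ⟨m, rfl⟩ := hk
  rw [pow_succ, pow_mul, pow_two, z_mul_z, one_pow, one_mul]

theorem not_odd_orderOf_z_mul {n : ℕ} {g : Cover n} (hg : Odd (orderOf g)) :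
    ¬ Odd (orderOf (z n * g)) := by
  intro h
  have h1 : (z n * g) ^ (orderOf (z n * g) * orderOf g) = 1 := by
    rw [pow_mul, pow_orderOf_eq_one, one_pow]
  rw [z_mul_pow, z_pow_of_odd (h.mul hg), mul_comm (orderOf _), pow_mul, pow_orderOf_eq_one,
    one_pow, mul_one] at h1
  exact z_ne_one n h1

/-- If $g^m=z$ with $m$ odd, then $(zg)^m=z^{m+1}=1$. -/
theorem odd_orderOf_or {n : ℕ} {g : Cover n} (hg : Odd (orderOf (proj n g))) :
    Odd (orderOf g) ∨ Odd (orderOf (z n * g)) := by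
  have h1 : proj n (g ^ orderOf (proj n g)) = 1 := by rw [map_pow, pow_orderOf_eq_one]
  rcases eq_one_or_eq_z_of_proj_eq_one h1 with h | h
  · exact Or.inl (hg.of_dvd_nat (orderOf_dvd_of_pow_eq_one h))
  · refine Or.inr (hg.of_dvd_nat (orderOf_dvd_of_pow_eq_one ?_))
    rw [z_mul_pow, z_pow_of_odd hg, h, z_mul_z]

theorem odd_orderOf_proj {n : ℕ} {g : Cover n} (hg : Odd (orderOf g)) :
    Odd (orderOf (proj n g)) :=
  hg.of_dvd_nat (orderOf_map_dvd _ _)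

theorem exists_odd_lift {n : ℕ} {w : Equiv.Perm (Fin n)} (hw : Odd (orderOf w)) :
    ∃ g : Cover n, proj n g = w ∧ Odd (orderOf g) := by
  rcases odd_orderOf_or (g := sec n w) (by rwa [proj_sec]) with h | h
  · exact ⟨_, proj_sec w, h⟩
  · exact ⟨_, by rw [proj_z_mul, proj_sec], h⟩

/-- Uniqueness of the odd-order lift. Commutation and conjugacy of odd-order lifts are reduced
through it to the same statements in $S_n$. -/
theorem eq_of_odd_orderOf {n : ℕ} {g h : Cover n} (e : proj n g = proj n h)
    (hg : Odd (orderOf g)) (hh : Odd (orderOf h)) : g = h := by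
  rcases eq_or_eq_z_mul e with h' | rfl
  · exact h'
  · exact absurd hg (not_odd_orderOf_z_mul hh)

theorem orderOf_conj' {G : Type*} [Group G] (g h : G) : orderOf (h * g * h⁻¹) = orderOf g :=
  orderOf_injective (MulAut.conj h).toMonoidHom (MulAut.conj h).injective g

theorem commute_of_odd_orderOf {n : ℕ} {g h : Cover n} (e : Commute (proj n g) (proj n h))
    (hh : Odd (orderOf h)) : Commute g h := by
  have : g * h * g⁻¹ = h := by
    refine eq_of_odd_orderOf ?_ (by rwa [orderOf_conj']) hh
    rw [map_mul, map_mul, map_inv, e.eq, mul_inv_cancel_right]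
  exact mul_inv_eq_iff_eq_mul.1 this

theorem odd_orderOf_mul {n : ℕ} {g h : Cover n} (e : Commute (proj n g) (proj n h))
    (hg : Odd (orderOf g)) (hh : Odd (orderOf h)) : Odd (orderOf (g * h)) :=
  (hg.mul hh).of_dvd_nat (commute_of_odd_orderOf e hh).orderOf_mul_dvd_mul_orderOf

theorem odd_orderOf_incl {n : ℕ} {g : Cover n} :
    Odd (orderOf (incl n g)) ↔ Odd (orderOf g) := by
  rw [orderOf_injective _ (incl_injective n)]

/-- The odd order elements over the permutations of modified type `lam`. -/
def oddClass (n : ℕ) (lam : EvenPartition) : Set (Cover n) :=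
  {g | Odd (orderOf g) ∧ (proj n g).cycleType = lam.1.map (· + 1)}

theorem oddClass_conj {n : ℕ} {lam : EvenPartition} {g : Cover n} (hg : g ∈ oddClass n lam)
    (h : Cover n) : h * g * h⁻¹ ∈ oddClass n lam := by
  refine ⟨by rw [orderOf_conj']; exact hg.1, ?_⟩
  rw [map_mul, map_mul, map_inv, Equiv.Perm.cycleType_conj, hg.2]

/-- Lift a permutation conjugating the images: the conjugated lift still has odd order, so
uniqueness identifies it with the other element. -/
theorem isConj_of_mem_oddClass {n : ℕ} {lam : EvenPartition} {g h : Cover n}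
    (hg : g ∈ oddClass n lam) (hh : h ∈ oddClass n lam) : IsConj g h := by
  obtain ⟨w, hw⟩ := isConj_iff.1 (Equiv.Perm.isConj_of_cycleType_eq (hg.2.trans hh.2.symm))
  obtain ⟨k, rfl⟩ := proj_surjective n w
  refine isConj_iff.2 ⟨k, eq_of_odd_orderOf ?_ (by rw [orderOf_conj']; exact hg.1) hh.1⟩
  rw [map_mul, map_mul, map_inv, hw]

theorem EvenPartition.ext_map {lam mu : EvenPartition}
    (h : lam.1.map (· + 1) = mu.1.map (· + 1)) : lam = mu :=
  Subtype.ext (Multiset.map_injective (add_left_injective 1) h)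

theorem eq_of_mem_oddClass {n : ℕ} {lam mu : EvenPartition} {g : Cover n}
    (h1 : g ∈ oddClass n lam) (h2 : g ∈ oddClass n mu) : lam = mu :=
  EvenPartition.ext_map (h1.2.symm.trans h2.2)

theorem odd_orderOf_of_cycleType {α : Type*} [Fintype α] [DecidableEq α] {w : Equiv.Perm α}
    (h : ∀ m ∈ w.cycleType, Odd m) : Odd (orderOf w) := by
  rw [← Equiv.Perm.lcm_cycleType]
  have : ∀ s : Multiset ℕ, (∀ m ∈ s, Odd m) → Odd s.lcm := by
    intro s
    induction s using Multiset.induction with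
    | empty => simp
    | cons a s ih =>
      intro h
      rw [Multiset.lcm_cons]
      exact ((h a (by simp)).mul (ih fun m hm => h m (by simp [hm]))).of_dvd_nat
        (lcm_dvd_mul _ _)
  exact this _ h

theorem EvenPartition.odd_of_mem_map (lam : EvenPartition) :
    ∀ m ∈ lam.1.map (· + 1), Odd m := by
  intro m hm
  obtain ⟨p, hp, rfl⟩ := Multiset.mem_map.1 hm
  exact (lam.2 p hp).2.add_one

theorem EvenPartition.sum_map (lam : EvenPartition) :
    (lam.1.map (· + 1)).sum = lam.size + lam.length := by
  simp [Multiset.sum_map_add, EvenPartition.size, EvenPartition.length]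

theorem exists_evenPartition {α : Type*} [Fintype α] [DecidableEq α] {w : Equiv.Perm α}
    (h : ∀ m ∈ w.cycleType, Odd m) : ∃ lam : EvenPartition, w.cycleType = lam.1.map (· + 1) := by
  refine ⟨⟨w.cycleType.map (· - 1), fun p hp => ?_⟩, ?_⟩
  · obtain ⟨m, hm, rfl⟩ := Multiset.mem_map.1 hp
    have h1 := Equiv.Perm.two_le_of_mem_cycleType hm
    have h2 := h m hm
    refine ⟨by omega, ?_⟩
    obtain ⟨k, rfl⟩ := h2
    simp
  · rw [Multiset.map_map]
    conv_lhs => rw [← Multiset.map_id w.cycleType]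
    refine Multiset.map_congr rfl fun m hm => ?_
    have h1 := Equiv.Perm.two_le_of_mem_cycleType hm
    simp only [id, Function.comp_apply]
    omega

theorem exists_mem_oddClass {n : ℕ} {g : Cover n} (hg : Odd (orderOf g)) :
    ∃ lam, g ∈ oddClass n lam := by
  obtain ⟨lam, h⟩ := exists_evenPartition (w := proj n g) (fun m hm =>
    (odd_orderOf_proj hg).of_dvd_nat (Equiv.Perm.dvd_of_mem_cycleType hm))
  exact ⟨lam, hg, h⟩

theorem odd_orderOf_proj_of_cycleType {n : ℕ} {lam : EvenPartition} {w : Equiv.Perm (Fin n)}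
    (h : w.cycleType = lam.1.map (· + 1)) : Odd (orderOf w) :=
  odd_orderOf_of_cycleType (by rw [h]; exact lam.odd_of_mem_map)

theorem oddClass_nonempty_iff {n : ℕ} {lam : EvenPartition} :
    (oddClass n lam).Nonempty ↔ lam.size + lam.length ≤ n := by
  constructor
  · rintro ⟨g, hg⟩
    have := (proj n g).sum_cycleType_le
    rw [hg.2, lam.sum_map] at this
    simpa using this
  · intro h
    obtain ⟨w, hw⟩ := (Equiv.Perm.exists_with_cycleType_iff (Fin n)
      (m := lam.1.map (· + 1))).2 ⟨by rw [lam.sum_map]; simpa using h, fun a ha => by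
        obtain ⟨p, hp, rfl⟩ := Multiset.mem_map.1 ha
        have := (lam.2 p hp).1
        omega⟩
    obtain ⟨g, hg, ho⟩ := exists_odd_lift (odd_orderOf_proj_of_cycleType hw)
    exact ⟨g, ho, by rw [hg, hw]⟩

theorem incl_mem_oddClass {n : ℕ} {lam : EvenPartition} {g : Cover n} :
    incl n g ∈ oddClass (n + 1) lam ↔ g ∈ oddClass n lam := by
  simp only [oddClass, Set.mem_ofPred_eq, odd_orderOf_incl, proj_incl, cycleType_emb]

theorem z_mul_notMem_oddClass {n : ℕ} {lam mu : EvenPartition} {g : Cover n}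
    (hg : g ∈ oddClass n lam) : z n * g ∉ oddClass n mu :=
  fun h => not_odd_orderOf_z_mul hg.1 h.1

theorem sign_of_odd_orderOf {α : Type*} [Fintype α] [DecidableEq α] {w : Equiv.Perm α}
    (h : Odd (orderOf w)) : Equiv.Perm.sign w = 1 := by
  have h1 : Equiv.Perm.sign w ^ orderOf w = 1 := by
    rw [← map_pow, pow_orderOf_eq_one, map_one]
  rcases Int.units_eq_one_or (Equiv.Perm.sign w) with h2 | h2
  · exact h2
  · rw [h2, h.neg_one_pow] at h1
    exact absurd h1 (by decide)

/-! ### Commutation of lifts of disjoint permutations -/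

/-- The commutator of lifts of disjoint permutations with signs `s` and `s'`. -/
def signZ (n : ℕ) (s s' : ℤˣ) : Cover n := if s = -1 ∧ s' = -1 then z n else 1

theorem signZ_comm {n : ℕ} (s s' : ℤˣ) (g : Cover n) : signZ n s s' * g = g * signZ n s s' := by
  unfold signZ; split_ifs
  · exact z_comm g
  · simp

theorem signZ_mul_right {n : ℕ} (s a b : ℤˣ) :
    signZ n s (a * b) = signZ n s a * signZ n s b := by
  rcases Int.units_eq_one_or s with rfl | rfl <;> rcases Int.units_eq_one_or a with rfl | rfl <;>
    rcases Int.units_eq_one_or b with rfl | rfl <;> simp [signZ, z_mul_z]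

theorem signZ_symm {n : ℕ} (a b : ℤˣ) : signZ n a b = signZ n b a := by
  simp only [signZ, and_comm]

theorem signZ_mul_self {n : ℕ} (a b : ℤˣ) : signZ n a b * signZ n a b = 1 := by
  unfold signZ; split_ifs
  · exact z_mul_z n
  · simp

theorem exists_perm_four {α : Type*} [DecidableEq α] [Finite α] {a b c d a' b' c' d' : α}
    (h : [a, b, c, d].Nodup) (h' : [a', b', c', d'].Nodup) :
    ∃ w : Equiv.Perm α, w a = a' ∧ w b = b' ∧ w c = c' ∧ w d = d' := by
  simp only [List.nodup_cons, List.mem_cons, List.not_mem_nil, or_false, not_or, List.nodup_nil,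
    not_false_eq_true, and_true] at h h'
  obtain ⟨⟨hab, hac, had⟩, ⟨hbc, hbd⟩, hcd⟩ := h
  obtain ⟨⟨hab', hac', had'⟩, ⟨hbc', hbd'⟩, hcd'⟩ := h'
  let s : Set α := {a, b, c, d}
  let f : α → α := fun x => if x = a then a' else if x = b then b' else if x = c then c' else d'
  have hf : Set.InjOn f s := by
    rintro x (rfl | rfl | rfl | rfl) y (rfl | rfl | rfl | rfl) <;> simp_all [f, eq_comm]
  obtain ⟨w, hw⟩ := Equiv.Perm.exists_extending_pair (Subtype.val : s → α) (fun x => f x)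
    Subtype.val_injective (fun x y hxy => Subtype.ext (hf x.2 y.2 hxy))
  refine ⟨w, ?_, ?_, ?_, ?_⟩
  · simpa [f] using hw ⟨a, by simp [s]⟩
  · simpa [f, hab, Ne.symm hab] using hw ⟨b, by simp [s]⟩
  · simpa [f, Ne.symm hac, Ne.symm hbc] using hw ⟨c, by simp [s]⟩
  · simpa [f, Ne.symm had, Ne.symm hbd, Ne.symm hcd] using hw ⟨d, by simp [s]⟩

/-- Conjugation moves the four points to $0,1,2,3$, where the claim is the relation between $t_0$
and $t_2$. Other lifts differ by the central $z$, which does not affect a commutator. -/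
theorem mul_comm_of_proj_swap {n : ℕ} {a b c d : Fin n} (h : [a, b, c, d].Nodup) {g k : Cover n}
    (hg : proj n g = Equiv.swap a b) (hk : proj n k = Equiv.swap c d) :
    g * k = z n * (k * g) := by
  have hn : 4 ≤ n := by simpa using h.length_le_card
  obtain ⟨w, h0, h1, h2, h3⟩ := exists_perm_four
    (a := (⟨0, by omega⟩ : Fin n)) (b := ⟨1, by omega⟩) (c := ⟨2, by omega⟩) (d := ⟨3, by omega⟩)
    (by simp) h
  obtain ⟨m, rfl⟩ := proj_surjective n w
  have e1 : proj n (m * t n 0 * m⁻¹) = proj n g := by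
    rw [map_mul, map_mul, map_inv, proj_t (by omega), adjSwap_eq (by omega), hg, ← h0, ← h1,
      Equiv.swap_apply_apply]
  have e2 : proj n (m * t n 2 * m⁻¹) = proj n k := by
    rw [map_mul, map_mul, map_inv, proj_t (by omega), adjSwap_eq (by omega), hk, ← h2, ← h3,
      Equiv.swap_apply_apply]
  have key : (m * t n 0 * m⁻¹) * (m * t n 2 * m⁻¹) =
      z n * ((m * t n 2 * m⁻¹) * (m * t n 0 * m⁻¹)) := by
    have := t_far (n := n) (i := 2) (j := 0) (by omega) (by omega) (Or.inr (by omega))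
    calc _ = m * (t n 0 * t n 2) * m⁻¹ := by group
      _ = m * z n * t n 2 * t n 0 * m⁻¹ := by rw [this]; group
      _ = _ := by rw [← z_comm]; group
  have hz := z_comm (n := n)
  have swap_z : ∀ x y : Cover n, x * (z n * y) = z n * (x * y) := fun x y => by
    rw [← mul_assoc, ← hz, mul_assoc]
  rcases eq_or_eq_z_mul e1.symm with h4 | h4 <;> rcases eq_or_eq_z_mul e2.symm with h5 | h5 <;>
    rw [h4, h5] <;> simp only [mul_assoc (z n), swap_z, key]

/-- The commutator of $g$ with a lift is multiplicative in the lift, so it is determined on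
transpositions. Working in `Subtype p` keeps all these transpositions inside the prescribed set. -/
theorem mul_comm_of_disjoint_aux {n : ℕ} {g : Cover n} {p : Fin n → Prop} [DecidablePred p]
    (s : ℤˣ) (base : ∀ a b : Fin n, a ≠ b → p a → p b → ∀ k : Cover n,
      proj n k = Equiv.swap a b → g * k = signZ n s (-1) * (k * g))
    (r : Equiv.Perm (Subtype p)) : ∀ k : Cover n, proj n k = Equiv.Perm.ofSubtype r →
      g * k = signZ n s (Equiv.Perm.sign r) * (k * g) := by
  induction r using Equiv.Perm.swap_induction_on with
  | one =>
    intro k hk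
    rw [map_one] at hk
    rcases eq_one_or_eq_z_of_proj_eq_one hk with rfl | rfl
    · simp [signZ]
    · simp [signZ, z_comm]
  | swap_mul f x y hxy ih =>
    intro k hk
    have hxy' : (x : Fin n) ≠ y := fun h => hxy (Subtype.ext h)
    have e : k = sec n (Equiv.swap x.1 y.1) * ((sec n (Equiv.swap x.1 y.1))⁻¹ * k) := by group
    have h1 := base x y hxy' x.2 y.2 _ (proj_sec _)
    have h2 := ih ((sec n (Equiv.swap x.1 y.1))⁻¹ * k) (by
      rw [map_mul, map_inv, proj_sec, hk, map_mul, Equiv.Perm.ofSubtype_swap_eq,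
        inv_mul_cancel_left])
    rw [e]
    set c := sec n (Equiv.swap x.1 y.1)
    set m := c⁻¹ * k
    rw [map_mul, Equiv.Perm.sign_swap hxy, signZ_mul_right, ← mul_assoc, h1]
    calc signZ n s (-1) * (c * g) * m = signZ n s (-1) * (c * (g * m)) := by simp only [mul_assoc]
      _ = signZ n s (-1) * (c * signZ n s (Equiv.Perm.sign f) * (m * g)) := by
        rw [h2]; simp only [mul_assoc]
      _ = _ := by rw [← signZ_comm]; simp only [mul_assoc]

theorem mul_comm_of_disjoint {n : ℕ} {g k : Cover n}
    (h : Equiv.Perm.Disjoint (proj n g) (proj n k)) :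
    g * k = signZ n (Equiv.Perm.sign (proj n g)) (Equiv.Perm.sign (proj n k)) * (k * g) := by
  have restrict : ∀ w : Equiv.Perm (Fin n), ∃ r : Equiv.Perm {x // w x ≠ x},
      Equiv.Perm.ofSubtype r = w := fun w =>
    ⟨w.subtypePerm (p := fun x => w x ≠ x) (fun x => by simp),
      Equiv.Perm.ofSubtype_subtypePerm _ (fun x hx => hx)⟩
  have step : ∀ a b : Fin n, a ≠ b → proj n g a ≠ a → proj n g b ≠ b → ∀ m : Cover n,
      proj n m = Equiv.swap a b →
      k * m = signZ n (Equiv.Perm.sign (proj n k)) (-1) * (m * k) := by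
    intro a b hab ha hb m hm
    obtain ⟨r, hr⟩ := restrict (proj n k)
    -- First $k$ is expanded into transpositions on its own support, against a fixed lift of a
    -- transposition in the support of $g$. The second application below expands $g$ itself.
    have := mul_comm_of_disjoint_aux (g := m) (p := fun x => proj n k x ≠ x) (-1)
      (fun c d hcd hc hd x hx => by
        rw [signZ, if_pos ⟨rfl, rfl⟩]
        refine mul_comm_of_proj_swap ?_ hm hx
        have hk : ∀ x, proj n g x ≠ x → proj n k x = x := fun x hx =>
          (h x).resolve_left hx
        have hac : a ≠ c := fun e => hc (e ▸ hk a ha)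
        have had : a ≠ d := fun e => hd (e ▸ hk a ha)
        have hbc : b ≠ c := fun e => hc (e ▸ hk b hb)
        have hbd : b ≠ d := fun e => hd (e ▸ hk b hb)
        simp [hab, hac, had, hbc, hbd, hcd]) r k hr.symm
    rw [← Equiv.Perm.sign_ofSubtype, hr] at this
    rw [this, ← mul_assoc, signZ_symm, signZ_mul_self, one_mul]
  obtain ⟨r, hr⟩ := restrict (proj n g)
  have := mul_comm_of_disjoint_aux (g := k) (p := fun x => proj n g x ≠ x) _
    (fun a b hab ha hb m hm => step a b hab ha hb m hm) r g hr.symm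
  rw [← Equiv.Perm.sign_ofSubtype, hr] at this
  rw [this, ← mul_assoc, signZ_symm, signZ_mul_self, one_mul]

/-- An antisymmetric class function supported on lifts of even permutations is supported on lifts
of odd order permutations. -/
theorem odd_orderOf_of_antisymm {n : ℕ} {f : Cover n → ℤ} (hz : ∀ g, f (z n * g) = -f g)
    (hc : ∀ g h, f (h * g * h⁻¹) = f g)
    (hs : ∀ g, f g ≠ 0 → Equiv.Perm.sign (proj n g) = 1) {g : Cover n} (hg : f g ≠ 0) :
    Odd (orderOf (proj n g)) := by
  refine odd_orderOf_of_cycleType fun m hm => ?_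
  by_contra hodd
  rw [Nat.not_odd_iff_even] at hodd
  -- Split off an even-length cycle $c$, which is an odd permutation. As $g$ lies over an even
  -- permutation, the rest $r$ is odd too, so the lifts anticommute; conjugation by the lift of $c$
  -- turns $g$ into $zg$ and gives $f(g)=-f(g)$.
  obtain ⟨c, r, hcr, hdis, hcyc, hcard⟩ := Equiv.Perm.mem_cycleType_iff.1 hm
  have sc : Equiv.Perm.sign c = -1 := by rw [hcyc.sign, hcard, hodd.neg_one_pow]
  have sr : Equiv.Perm.sign r = -1 := by
    have := hs g hg
    rw [hcr, map_mul, sc] at this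
    rcases Int.units_eq_one_or (Equiv.Perm.sign r) with h | h
    · rw [h] at this; exact absurd this (by decide)
    · exact h
  let C := sec n c
  have hC : proj n C = c := proj_sec c
  let R := C⁻¹ * g
  have hR : proj n R = r := by
    simp only [R]; rw [map_mul, map_inv, hC, hcr, inv_mul_cancel_left]
  have key := mul_comm_of_disjoint (g := C) (k := R) (by rw [hC, hR]; exact hdis)
  rw [hC, hR, sc, sr, signZ, if_pos ⟨rfl, rfl⟩] at key
  have e : C⁻¹ * g * C = z n * g := by
    have h1 : C * R = g := by simp [R]
    calc C⁻¹ * g * C = R * C := rfl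
      _ = z n * (C * R) := by rw [key, z_mul_z_mul]
      _ = _ := by rw [h1]
  have h2 := hc g C⁻¹
  rw [inv_inv, e, hz] at h2
  omega

/-! ### The elements `x_i` and the cycles -/

theorem x_last (m : ℕ) : x (m + 1) m = t (m + 2) m := by simp [x]

theorem x_eq_mul {n i : ℕ} (h : i + 1 < n) : x n i = t (n + 1) i * x n (i + 1) * t (n + 1) i := by
  have e : n - 1 - i = (n - 1 - (i + 1)) + 1 := by omega
  rw [x, x, e, List.range'_succ]
  simp [mul_assoc]

theorem t_inv {n i : ℕ} (h : i + 1 < n) : (t n i)⁻¹ = z n * t n i := by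
  rw [inv_eq_iff_mul_eq_one, ← mul_assoc, ← z_mul_t, mul_assoc, t_mul_t h, z_mul_z]

/-- When $i=n-1$ this is the braid relation. Otherwise the outer $t_i$ commutes with $t_n$ up to $z$
on each side, and the two factors $z$ cancel. -/
theorem x_succ {n i : ℕ} (h : i < n) :
    x (n + 1) i = t (n + 2) n * incl (n + 1) (x n i) * t (n + 2) n := by
  obtain ⟨k, hk⟩ : ∃ k, i + k + 1 = n := ⟨n - 1 - i, by omega⟩
  induction k generalizing i with
  | zero =>
    obtain rfl : n = i + 1 := by omega
    rw [x_eq_mul (by omega), x_last, x_last, incl_t (by omega), t_braid (by omega)]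
  | succ k ih =>
    rw [x_eq_mul (by omega), ih (by omega) (by omega), x_eq_mul (i := i) (n := n) (by omega),
      map_mul, map_mul, incl_t (by omega)]
    have c1 : t (n + 2) i * t (n + 2) n = z (n + 2) * t (n + 2) n * t (n + 2) i :=
      t_far (by omega) (by omega) (Or.inr (by omega))
    have c2 : t (n + 2) n * t (n + 2) i = z (n + 2) * t (n + 2) i * t (n + 2) n :=
      t_far (by omega) (by omega) (Or.inl (by omega))
    set X := incl (n + 1) (x n (i + 1))
    rw [mul_assoc] at c1 c2
    have h3 : ∀ P P' Q Q' : Cover (n + 2), P = z (n + 2) * P' → Q = z (n + 2) * Q' →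
        P * X * Q = P' * X * Q' := by
      rintro _ P' _ Q' rfl rfl
      rw [mul_assoc (z (n + 2)), mul_assoc (z (n + 2)), ← mul_assoc (P' * X), ← z_comm (P' * X),
        mul_assoc, z_mul_z_mul]
    calc t (n + 2) i * (t (n + 2) n * X * t (n + 2) n) * t (n + 2) i
        = (t (n + 2) i * t (n + 2) n) * X * (t (n + 2) n * t (n + 2) i) := by
          simp only [mul_assoc]
      _ = (t (n + 2) n * t (n + 2) i) * X * (t (n + 2) i * t (n + 2) n) := h3 _ _ _ _ c1 c2
      _ = _ := by simp only [mul_assoc]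

/-- Since $t_n^{-1}=zt_n$, sandwiching between two $t_n$ is conjugation times $z$; each factor $x_i$
thus contributes one $z$ when $n$ grows. -/
theorem x_succ' {n i : ℕ} (h : i < n) :
    x (n + 1) i = z (n + 2) * (t (n + 2) n * incl (n + 1) (x n i) * (t (n + 2) n)⁻¹) := by
  rw [x_succ h, t_inv (by omega)]
  simp only [mul_assoc]
  rw [← mul_assoc (incl (n + 1) (x n i)), ← z_comm, mul_assoc, ← mul_assoc _ (z (n + 2)), ← z_comm,
    mul_assoc, z_mul_z_mul]

theorem prod_x_succ {n : ℕ} (l : List ℕ) (h : ∀ i ∈ l, i < n) :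
    (l.map (x (n + 1))).prod = z (n + 2) ^ l.length *
      (t (n + 2) n * incl (n + 1) (l.map (x n)).prod * (t (n + 2) n)⁻¹) := by
  induction l with
  | nil => simp
  | cons i l ih =>
    rw [List.map_cons, List.prod_cons, ih (fun j hj => h j (by simp [hj])),
      x_succ' (h i (by simp)), List.map_cons, List.prod_cons, map_mul, List.length_cons, pow_succ']
    have hz : ∀ k (g : Cover (n + 2)), g * z (n + 2) ^ k = z (n + 2) ^ k * g := fun k g =>
      (((show Commute (z (n + 2)) g from z_comm g).pow_left k).eq).symm
    simp only [mul_assoc]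
    congr 1
    rw [← mul_assoc _ (z (n + 2) ^ l.length), hz]
    simp only [mul_assoc]
    rw [← mul_assoc _ (z (n + 2) ^ l.length), hz]
    simp only [mul_assoc]
    rw [← mul_assoc _ (z (n + 2) ^ l.length), hz]
    simp only [mul_assoc, inv_mul_cancel_left]

theorem cycle_cons_cons (n i j : ℕ) (l : List ℕ) :
    cycle n (i :: j :: l) = ((i :: ((j :: l).reverse ++ [i])).map (x n)).prod := by
  simp [cycle, mul_assoc]

/-- A cycle on $m$ points has $m+1$ factors $x_i$, so for odd $m$ the factors $z$ cancel. This is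
where even parts enter: the element is conjugated without any sign. -/
theorem cycle_succ {n : ℕ} (l : List ℕ) (h : ∀ i ∈ l, i < n) (hodd : Odd l.length)
    (hl : 1 < l.length) :
    cycle (n + 1) l = t (n + 2) n * incl (n + 1) (cycle n l) * (t (n + 2) n)⁻¹ := by
  match l, hl with
  | i :: j :: l, _ =>
    rw [cycle_cons_cons, cycle_cons_cons, prod_x_succ _ (fun k hk => h k (by
      simp only [List.mem_cons, List.mem_append, List.mem_reverse, List.not_mem_nil, or_false]
        at hk ⊢
      tauto))]
    have : z (n + 2) ^ (i :: ((j :: l).reverse ++ [i])).length = 1 := by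
      have e : (i :: ((j :: l).reverse ++ [i])).length = (i :: j :: l).length + 1 := by simp
      obtain ⟨m, hm⟩ := hodd
      rw [e, hm, show 2 * m + 1 + 1 = 2 * (m + 1) by ring, pow_mul, pow_two, z_mul_z, one_pow]
    rw [this, one_mul]

/-- The number of points moved by `blockCycles`. -/
def blockSize (ps : List ℕ) : ℕ := (ps.map (· + 1)).sum

theorem blockCycles_succ {n : ℕ} (ps : List ℕ) (hps : ∀ p ∈ ps, 0 < p ∧ Even p) (a : ℕ)
    (h : a + blockSize ps ≤ n) : blockCycles (n + 1) a ps =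
      t (n + 2) n * incl (n + 1) (blockCycles n a ps) * (t (n + 2) n)⁻¹ := by
  induction ps generalizing a with
  | nil => simp [blockCycles]
  | cons p ps ih =>
    obtain ⟨h1, h2⟩ := hps p (by simp)
    have h3 : blockSize (p :: ps) = p + 1 + blockSize ps := by simp [blockSize]
    rw [blockCycles, blockCycles, ih (fun q hq => hps q (by simp [hq])) _ (by omega),
      cycle_succ _ (fun i hi => by
        rw [List.mem_range'_1] at hi
        omega) (by simpa using h2.add_one) (by simpa using h1), map_mul]
    simp only [mul_assoc, inv_mul_cancel_left]

/-! ### Cycle types of the distinguished elements -/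

theorem swap_conj_swap {α : Type*} [DecidableEq α] {a b c : α} (hac : a ≠ c)
    (hbc : b ≠ c) : Equiv.swap a b * Equiv.swap b c * Equiv.swap a b = Equiv.swap a c := by
  conv_lhs => rw [← Equiv.swap_inv (x := a) (y := b)]
  have := Equiv.swap_apply_apply (Equiv.swap a b) b c
  rw [Equiv.swap_apply_right, Equiv.swap_apply_of_ne_of_ne hac.symm hbc.symm] at this
  rw [this]
  simp

theorem proj_x {n i : ℕ} (h : i < n) :
    proj (n + 1) (x n i) = Equiv.swap (Fin.ofNat (n + 1) i) (Fin.last n) := by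
  have hc : ∀ j (hj : j < n + 1), Fin.ofNat (n + 1) j = ⟨j, hj⟩ := fun j hj =>
    Fin.ext (Nat.mod_eq_of_lt hj)
  obtain ⟨k, hk⟩ : ∃ k, i + k + 1 = n := ⟨n - 1 - i, by omega⟩
  induction k generalizing i with
  | zero =>
    obtain rfl : n = i + 1 := by omega
    rw [x_last, proj_t (by omega), adjSwap_eq (by omega), hc i (by omega)]
    rfl
  | succ k ih =>
    rw [x_eq_mul (by omega), map_mul, map_mul, ih (by omega) (by omega), proj_t (by omega),
      adjSwap_eq (by omega), hc i (by omega), hc (i + 1) (by omega)]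
    exact swap_conj_swap (Fin.ne_of_val_ne (by simp; omega)) (Fin.ne_of_val_ne (by simp; omega))

/-- Each further transposition prepends its point to the cycle, and a rotation of the list moves it
to the end. -/
theorem prod_swap_eq_formPerm {α : Type*} [DecidableEq α] (a : α) (l : List α)
    (h : (a :: l).Nodup) :
    (l.map fun i => Equiv.swap i a).prod = (a :: l.reverse).formPerm := by
  induction l with
  | nil => simp
  | cons b l ih =>
    have h' : (a :: l).Nodup := h.sublist (by simp)
    rw [List.map_cons, List.prod_cons, ih h']
    have h2 : (b :: a :: l.reverse).Nodup := by
      simp only [List.nodup_cons, List.mem_cons, List.mem_reverse, List.nodup_reverse] at h ⊢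
      tauto
    have := List.formPerm_rotate_one _ h2
    rw [← List.formPerm_cons_cons, ← this]
    simp

theorem formPerm_conj {α : Type*} [DecidableEq α] (w : Equiv.Perm α) (l : List α) :
    w * l.formPerm * w⁻¹ = (l.map w).formPerm := by
  match l with
  | [] => simp
  | [a] => simp
  | a :: b :: l =>
    rw [List.formPerm_cons_cons, List.map_cons, List.map_cons, List.formPerm_cons_cons,
      ← List.map_cons, ← formPerm_conj w (b :: l), Equiv.swap_apply_apply]
    group

/-- The inner factors give a cycle through the auxiliary last point; conjugation by the
transposition $(i_1,n)$ replaces that point by $i_1$. -/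
theorem proj_cycle {n : ℕ} (l : List ℕ) (h : ∀ i ∈ l, i < n) (hd : l.Nodup) (hl : 1 < l.length) :
    proj (n + 1) (cycle n l) = (l.map (Fin.ofNat (n + 1))).formPerm := by
  match l, hl with
  | i :: j :: l, _ =>
    have hc : ∀ k, k < n → (Fin.ofNat (n + 1) k).val = k := fun k hk =>
      Nat.mod_eq_of_lt (by omega)
    have hinj : ∀ l' : List ℕ, (∀ k ∈ l', k < n) → l'.Nodup →
        (l'.map (Fin.ofNat (n + 1))).Nodup := fun l' h' hd' =>
      (List.nodup_map_iff_inj_on hd').2 fun a ha b hb e => by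
        rw [← hc a (h' a ha), ← hc b (h' b hb), e]
    have hlast : ∀ l' : List ℕ, (∀ k ∈ l', k < n) →
        Fin.last n ∉ l'.map (Fin.ofNat (n + 1)) := by
      intro l' h' hm
      obtain ⟨k, hk, e⟩ := List.mem_map.1 hm
      have := congrArg Fin.val e
      rw [hc k (h' k hk)] at this
      exact absurd (h' k hk) (by simp at this; omega)
    have hp : ∀ l' : List ℕ, (∀ k ∈ l', k < n) →
        proj (n + 1) (l'.map (x n)).prod =
          ((l'.map (Fin.ofNat (n + 1))).map fun k => Equiv.swap k (Fin.last n)).prod := by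
      intro l' h'
      rw [map_list_prod, List.map_map, List.map_map]
      exact congrArg List.prod (List.map_congr_left fun k hk => proj_x (h' k hk))
    have hjl : ∀ k ∈ j :: l, k < n := fun k hk => h k (List.mem_cons_of_mem _ hk)
    have hjl' : ∀ k ∈ (j :: l).reverse, k < n := fun k hk => hjl k (List.mem_reverse.1 hk)
    rw [cycle, map_mul, map_mul, hp _ hjl', proj_x (h i (by simp)), prod_swap_eq_formPerm _ _
      (List.nodup_cons.2 ⟨hlast _ hjl', hinj _ hjl' (List.nodup_reverse.2 (List.nodup_cons.1 hd).2)⟩),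
      List.map_reverse, List.reverse_reverse]
    conv_lhs => rw [← Equiv.swap_inv (x := Fin.ofNat (n + 1) i) (y := Fin.last n)]
    rw [Equiv.swap_inv]
    -- The right-hand transposition is written as its own inverse, so that `formPerm_conj` applies.
    conv_lhs =>
      arg 2
      rw [← Equiv.swap_inv]
    rw [formPerm_conj, List.map_cons, Equiv.swap_apply_right]
    rw [List.map_cons (l := j :: l)]
    congr 2
    conv_rhs => rw [← List.map_id (List.map (Fin.ofNat (n + 1)) (j :: l))]
    refine List.map_congr_left fun k hk => ?_
    refine Equiv.swap_apply_of_ne_of_ne (fun e => ?_) (fun e => hlast _ hjl (e ▸ hk))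
    have := hinj _ h hd
    rw [List.map_cons, List.nodup_cons] at this
    exact this.1 (e ▸ hk)

/-- The support bound is carried through the induction to make each block disjoint from the later
ones, so that cycle types add. -/
theorem proj_blockCycles {n : ℕ} (ps : List ℕ) (hps : ∀ p ∈ ps, 0 < p) (a : ℕ)
    (h : a + blockSize ps ≤ n) :
    (proj (n + 1) (blockCycles n a ps)).cycleType = (ps.map (· + 1) : List ℕ) ∧
      ∀ y : Fin (n + 1), y.val < a ∨ a + blockSize ps ≤ y.val →
        proj (n + 1) (blockCycles n a ps) y = y := by
  induction ps generalizing a with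
  | nil => simp [blockCycles]
  | cons p ps ih =>
    have h1 := hps p (by simp)
    have h3 : blockSize (p :: ps) = p + 1 + blockSize ps := by simp [blockSize]
    obtain ⟨ih1, ih2⟩ := ih (fun q hq => hps q (by simp [hq])) (a + (p + 1)) (by omega)
    have hr : ∀ i ∈ List.range' a (p + 1), i < n := fun i hi => by
      rw [List.mem_range'_1] at hi; omega
    have hc := proj_cycle (n := n) (List.range' a (p + 1)) hr List.nodup_range' (by simpa using h1)
    set l := (List.range' a (p + 1)).map (Fin.ofNat (n + 1)) with hl
    have hnd : l.Nodup := (List.nodup_map_iff_inj_on List.nodup_range').2 fun b hb c hc e => by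
      have := congrArg Fin.val e
      rwa [Fin.val_ofNat, Fin.val_ofNat, Nat.mod_eq_of_lt (by have := hr b hb; omega),
        Nat.mod_eq_of_lt (by have := hr c hc; omega)] at this
    have hlen : l.length = p + 1 := by simp [hl]
    have hmem : ∀ y ∈ l, a ≤ y.val ∧ y.val < a + (p + 1) := by
      intro y hy
      obtain ⟨k, hk, rfl⟩ := List.mem_map.1 hy
      have := hr k hk
      rw [Fin.val_ofNat, Nat.mod_eq_of_lt (by omega)]
      rw [List.mem_range'_1] at hk; omega
    have hfix : ∀ y : Fin (n + 1), y.val < a ∨ a + (p + 1) ≤ y.val → l.formPerm y = y :=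
      fun y hy => List.formPerm_apply_of_notMem (fun hm => by have := hmem y hm; omega)
    have hdisj : Equiv.Perm.Disjoint (proj (n + 1) (cycle n (List.range' a (p + 1))))
        (proj (n + 1) (blockCycles n (a + (p + 1)) ps)) := by
      intro y
      rw [hc]
      by_cases hy : y.val < a + (p + 1)
      · exact Or.inr (ih2 y (Or.inl hy))
      · exact Or.inl (hfix y (Or.inr (by omega)))
    have hct : l.formPerm.cycleType = {p + 1} := by
      rw [(List.isCycle_formPerm hnd (by omega)).cycleType, List.support_formPerm_of_nodup l hnd
        (fun y e => by rw [e] at hlen; simp at hlen; omega), List.toFinset_card_of_nodup hnd, hlen]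
    constructor
    · rw [blockCycles, map_mul, hdisj.cycleType_mul, ih1, hc, hct]
      simp
    · intro y hy
      rw [blockCycles, map_mul, Equiv.Perm.mul_apply, ih2 y (by omega), hc, hfix y (by omega)]

theorem EvenPartition.blockSize_sort (lam : EvenPartition) :
    blockSize (lam.1.sort (· ≥ ·)) = lam.size + lam.length := by
  rw [← lam.sum_map, blockSize, ← Multiset.sum_coe, ← Multiset.map_coe, Multiset.sort_eq]

theorem proj_tElem {n : ℕ} {lam : EvenPartition} (h : lam.size + lam.length ≤ n) :
    (proj (n + 1) (tElem n lam)).cycleType = lam.1.map (· + 1) ∧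
      proj (n + 1) (tElem n lam) (Fin.last n) = Fin.last n := by
  obtain ⟨h1, h2⟩ := proj_blockCycles (n := n) (lam.1.sort (· ≥ ·))
    (fun p hp => (lam.2 p ((Multiset.mem_sort _).1 hp)).1) 0 (by rw [lam.blockSize_sort]; omega)
  refine ⟨?_, h2 _ (Or.inr ?_)⟩
  · rw [tElem, h1, ← Multiset.map_coe, Multiset.sort_eq]
  · rw [lam.blockSize_sort]; simpa using h

theorem tElem_succ {n : ℕ} {lam : EvenPartition} (h : lam.size + lam.length ≤ n) :
    tElem (n + 1) lam = t (n + 2) n * incl (n + 1) (tElem n lam) * (t (n + 2) n)⁻¹ :=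
  blockCycles_succ _ (fun p hp => lam.2 p ((Multiset.mem_sort _).1 hp)) 0
    (by rw [lam.blockSize_sort]; omega)

/-! ### The classes `D_λ(n)` -/

/-- The sign `1` or `-1` according to whether `t_λ` has odd order or not. -/
def classSign (lam : EvenPartition) : ℤ :=
  if Odd (orderOf (tElem (lam.size + lam.length) lam)) then 1 else -1

theorem classSign_mul_self (lam : EvenPartition) : classSign lam * classSign lam = 1 := by
  unfold classSign; split_ifs <;> simp

/-- Passing from $n$ to $n+1$ only includes and conjugates $t_\lambda$. Hence one sign `classSign`
serves all $n$, which stability of the structure constants needs. -/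
theorem odd_orderOf_tElem {n : ℕ} {lam : EvenPartition} (h : lam.size + lam.length ≤ n) :
    Odd (orderOf (tElem n lam)) ↔ Odd (orderOf (tElem (lam.size + lam.length) lam)) := by
  induction n, h using Nat.le_induction with
  | base => rfl
  | succ n h ih => rw [tElem_succ h, orderOf_conj', odd_orderOf_incl, ih]

theorem mem_D_iff_of_odd {n : ℕ} {lam : EvenPartition}
    (hodd : Odd (orderOf (tElem (lam.size + lam.length) lam))) (g : Cover n) :
    g ∈ D n lam ↔ g ∈ oddClass n lam := by
  constructor
  · rintro ⟨h, g₀, e, hc⟩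
    obtain ⟨k, rfl⟩ := isConj_iff.1 hc
    refine oddClass_conj ?_ k
    rw [← incl_mem_oddClass, e]
    exact ⟨(odd_orderOf_tElem h).2 hodd, (proj_tElem h).1⟩
  · intro hg
    have h := oddClass_nonempty_iff.1 ⟨g, hg⟩
    obtain ⟨g₀, e⟩ := mem_range_incl (proj_tElem h).2
    refine ⟨h, g₀, e, isConj_of_mem_oddClass (lam := lam) ?_ hg⟩
    rw [← incl_mem_oddClass, e]
    exact ⟨(odd_orderOf_tElem h).2 hodd, (proj_tElem h).1⟩

/-- If $t_\lambda$ is not the odd-order lift then $zt_\lambda$ is, so the class is $z$ times the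
odd-order class. -/
theorem mem_D_iff_of_not_odd {n : ℕ} {lam : EvenPartition}
    (hodd : ¬ Odd (orderOf (tElem (lam.size + lam.length) lam))) (g : Cover n) :
    g ∈ D n lam ↔ z n * g ∈ oddClass n lam := by
  have key : ∀ (h : lam.size + lam.length ≤ n) (g₀ : Cover n), incl n g₀ = tElem n lam →
      z n * g₀ ∈ oddClass n lam := by
    intro h g₀ e
    have h1 := (proj_tElem h).1
    rw [← incl_mem_oddClass, map_mul, incl_z, e]
    refine ⟨?_, by rw [proj_z_mul]; exact h1⟩
    exact (odd_orderOf_or (odd_orderOf_proj_of_cycleType h1)).resolve_left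
      (fun h2 => hodd ((odd_orderOf_tElem h).1 h2))
  have zc : ∀ k g₀ : Cover n, z n * (k * g₀ * k⁻¹) = k * (z n * g₀) * k⁻¹ := fun k g₀ => by
    rw [← mul_assoc, ← mul_assoc, z_comm, mul_assoc k]
  constructor
  · rintro ⟨h, g₀, e, hc⟩
    obtain ⟨k, rfl⟩ := isConj_iff.1 hc
    rw [zc]
    exact oddClass_conj (key h g₀ e) k
  · intro hg
    have h := oddClass_nonempty_iff.1 ⟨_, hg⟩
    obtain ⟨g₀, e⟩ := mem_range_incl (proj_tElem h).2
    obtain ⟨k, hk⟩ := isConj_iff.1 (isConj_of_mem_oddClass (key h g₀ e) hg)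
    refine ⟨h, g₀, e, isConj_iff.2 ⟨k, ?_⟩⟩
    rw [← zc] at hk
    exact mul_left_cancel hk

/-! ### Antisymmetric coefficients in the spin group algebra -/

/-- The quotient map onto the spin group algebra. -/
abbrev spinMk (n : ℕ) : MonoidAlgebra ℤ (Cover n) →+* SpinAlgebra n := (spinIdeal n).ringCon.mk'

/-- The antisymmetrised coefficients `g ↦ a(g) - a(zg)`. -/
def antisym (n : ℕ) : MonoidAlgebra ℤ (Cover n) →+ (Cover n → ℤ) where
  toFun a g := a.coeff g - a.coeff (z n * g)
  map_zero' := by ext; simp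
  map_add' a b := by ext g; simp; ring

theorem antisym_apply {n : ℕ} (a : MonoidAlgebra ℤ (Cover n)) (g : Cover n) :
    antisym n a g = a.coeff g - a.coeff (z n * g) := rfl

theorem antisym_z_mul {n : ℕ} (a : MonoidAlgebra ℤ (Cover n)) (g : Cover n) :
    antisym n a (z n * g) = -antisym n a g := by
  simp [antisym_apply, z_mul_z_mul]

theorem spinMk_eq_zero_iff_mem {n : ℕ} {a : MonoidAlgebra ℤ (Cover n)} :
    spinMk n a = 0 ↔ a ∈ spinIdeal n := by
  rw [TwoSidedIdeal.mem_iff]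
  exact (spinIdeal n).ringCon.eq (a := a) (b := 0)

theorem single_z_comm {n : ℕ} (a : MonoidAlgebra ℤ (Cover n)) :
    MonoidAlgebra.single (z n) 1 * a = a * MonoidAlgebra.single (z n) 1 := by
  ext g
  simp [z_inv, z_comm]

/-- Multiplication by $z$ fixes the generator $z+1$, hence, $z$ being central, the whole ideal; so
coefficients at $g$ and $zg$ agree. -/
theorem antisym_eq_zero_of_mem {n : ℕ} {a : MonoidAlgebra ℤ (Cover n)} (ha : a ∈ spinIdeal n) :
    antisym n a = 0 := by
  have key : MonoidAlgebra.single (z n) 1 * a = a := by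
    unfold spinIdeal at ha
    induction ha using TwoSidedIdeal.span_induction with
    | mem a h =>
      rw [Set.mem_singleton_iff] at h
      subst h
      rw [mul_add, MonoidAlgebra.single_mul_single, z_mul_z, mul_one, mul_one, add_comm]
      rfl
    | zero => simp
    | add a b _ _ ha hb => rw [mul_add, ha, hb]
    | neg a _ ha => rw [mul_neg, ha]
    | left_absorb b a _ ha => rw [← mul_assoc, single_z_comm, mul_assoc, ha]
    | right_absorb b a _ ha => rw [← mul_assoc, ha]
  ext g
  have h := congrArg (fun b => b.coeff g) key
  simp only [MonoidAlgebra.coeff_single_mul_apply, z_inv, one_mul] at h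
  rw [antisym_apply, h]
  simp

theorem spinMk_z_mul {n : ℕ} (g : Cover n) (r : ℤ) :
    spinMk n (MonoidAlgebra.single (z n * g) r) = -spinMk n (MonoidAlgebra.single g r) := by
  have h : spinMk n (MonoidAlgebra.single (z n) 1 + 1) = 0 :=
    spinMk_eq_zero_iff_mem.2 (TwoSidedIdeal.subset_span rfl)
  have h2 : MonoidAlgebra.single (z n * g) r =
      MonoidAlgebra.single (z n) 1 * MonoidAlgebra.single g r := by simp
  rw [h2, map_mul]
  rw [map_add, map_one] at h
  rw [eq_neg_of_add_eq_zero_left h, neg_one_mul]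

/-- Modulo $z+1$ the fibre $\{g,zg\}$ collapses to one representative up to sign, with the
antisymmetrised coefficient as its total weight. -/
theorem spinMk_eq_sum {n : ℕ} (a : MonoidAlgebra ℤ (Cover n)) :
    spinMk n a = ∑ w, antisym n a (sec n w) • spinMk n (MonoidAlgebra.single (sec n w) 1) := by
  have hs : ∀ (g : Cover n) (r : ℤ), spinMk n (MonoidAlgebra.single g r) =
      r • spinMk n (MonoidAlgebra.single g 1) := by
    intro g r
    rw [← map_zsmul]
    simp
  induction a using MonoidAlgebra.induction_linear with
  | zero => simp
  | add a b ha hb =>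
    rw [map_add, ha, hb, map_add, ← Finset.sum_add_distrib]
    simp only [Pi.add_apply, add_smul]
  | single g r =>
    have e1 : antisym n (MonoidAlgebra.single g r) g = r := by
      rw [antisym_apply]
      simp [(z_mul_ne g).symm]
    rw [Finset.sum_eq_single (proj n g)]
    · rcases eq_or_eq_z_mul (g := g) (h := sec n (proj n g)) (by rw [proj_sec]) with h | h
      · rw [← h, e1, hs]
      · have h' : sec n (proj n g) = z n * g := by
          conv_rhs => rw [h, z_mul_z_mul]
        rw [h', antisym_z_mul, e1, spinMk_z_mul, neg_smul_neg, hs]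
    · intro w _ hw
      have h1 : g ≠ sec n w := fun h => hw (by rw [h, proj_sec])
      have h2 : g ≠ z n * sec n w := fun h => hw (by rw [h, proj_z_mul, proj_sec])
      rw [antisym_apply]
      simp [h1, h2]
    · simp

/-- Equality in the quotient becomes equality of integer-valued functions; every later computation
in the spin algebra rests on this. -/
theorem spinMk_eq_iff {n : ℕ} {a b : MonoidAlgebra ℤ (Cover n)} :
    spinMk n a = spinMk n b ↔ antisym n a = antisym n b := by
  constructor
  · intro h
    rw [← sub_eq_zero, ← map_sub, spinMk_eq_zero_iff_mem] at h
    rw [← sub_eq_zero, ← map_sub]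
    exact antisym_eq_zero_of_mem h
  · intro h
    rw [spinMk_eq_sum a, spinMk_eq_sum b, h]

/-! ### Class sums of odd order classes -/

open scoped Classical in
/-- The class sum of `oddClass n lam` in the integral group algebra. -/
def oddSum (n : ℕ) (lam : EvenPartition) : MonoidAlgebra ℤ (Cover n) :=
  ∑ g, if g ∈ oddClass n lam then MonoidAlgebra.single g 1 else 0

open scoped Classical in
theorem coeff_oddSum {n : ℕ} (lam : EvenPartition) (g : Cover n) :
    (oddSum n lam).coeff g = if g ∈ oddClass n lam then 1 else 0 := by
  rw [oddSum, MonoidAlgebra.coeff_sum, Finsupp.finsetSum_apply, Finset.sum_eq_single g]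
  · split_ifs <;> simp
  · intro h _ hne
    split_ifs <;> simp [hne]
  · simp

theorem antisym_oddSum_of_mem {n : ℕ} {lam : EvenPartition} {g : Cover n}
    (hg : g ∈ oddClass n lam) : antisym n (oddSum n lam) g = 1 := by
  rw [antisym_apply, coeff_oddSum, coeff_oddSum, if_pos hg, if_neg (z_mul_notMem_oddClass hg),
    sub_zero]

theorem antisym_oddSum_of_mem_of_ne {n : ℕ} {lam mu : EvenPartition} {g : Cover n}
    (hg : g ∈ oddClass n lam) (h : mu ≠ lam) : antisym n (oddSum n mu) g = 0 := by
  rw [antisym_apply, coeff_oddSum, coeff_oddSum, if_neg (fun h' => h (eq_of_mem_oddClass h' hg)),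
    if_neg (z_mul_notMem_oddClass hg), sub_zero]

theorem antisym_oddSum_of_not_odd {n : ℕ} (mu : EvenPartition) {g : Cover n}
    (hg : ¬ Odd (orderOf (proj n g))) : antisym n (oddSum n mu) g = 0 := by
  rw [antisym_apply, coeff_oddSum, coeff_oddSum, if_neg (fun h => hg (odd_orderOf_proj h.1)),
    if_neg (fun h => hg (by have := odd_orderOf_proj h.1; rwa [proj_z_mul] at this)), sub_zero]

theorem classSum_eq (n : ℕ) (lam : EvenPartition) :
    classSum n lam = classSign lam • spinMk n (oddSum n lam) := by
  classical
  rw [classSum, ← map_zsmul]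
  refine spinMk_eq_iff.2 ?_
  have hD : ∀ g : Cover n, (∑ᶠ g ∈ D n lam, MonoidAlgebra.single g (1 : ℤ)).coeff g =
      if g ∈ D n lam then 1 else 0 := by
    intro g
    rw [finsum_mem_eq_toFinset_sum, MonoidAlgebra.coeff_sum, Finsupp.finsetSum_apply]
    simp [Finsupp.single_apply]
  ext g
  rw [map_zsmul, Pi.smul_apply, antisym_apply, antisym_apply, hD, hD, coeff_oddSum, coeff_oddSum]
  by_cases hodd : Odd (orderOf (tElem (lam.size + lam.length) lam))
  · simp only [mem_D_iff_of_odd hodd, classSign, if_pos hodd, one_smul]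
  · simp only [mem_D_iff_of_not_odd hodd, classSign, if_neg hodd, z_mul_z_mul, smul_eq_mul]
    ring

/-! ### Expansions -/

/-- Distinct partitions give disjoint nonempty classes in a finite group. -/
theorem finite_nonempty_oddClass (n : ℕ) :
    {lam : EvenPartition | lam.size + lam.length ≤ n}.Finite := by
  choose! f hf using fun lam : {lam : EvenPartition // lam.size + lam.length ≤ n} =>
    oddClass_nonempty_iff.2 lam.2
  have : Function.Injective f := fun a b e =>
    Subtype.ext (eq_of_mem_oddClass (hf a) (e ▸ hf b))
  exact @Set.toFinite _ _ (Finite.of_injective f this)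

theorem spinMk_sum_classSum {n : ℕ} (c : EvenPartition →₀ ℤ) :
    (c.sum fun nu k => k • classSum n nu) =
      spinMk n (c.sum fun nu k => (k * classSign nu) • oddSum n nu) := by
  rw [map_finsuppSum]
  refine Finsupp.sum_congr fun nu _ => ?_
  rw [map_zsmul, classSum_eq, mul_smul]

theorem antisym_sum_oddSum {n : ℕ} (c : EvenPartition →₀ ℤ) {lam : EvenPartition} {g : Cover n}
    (hg : g ∈ oddClass n lam) :
    antisym n (c.sum fun nu k => (k * classSign nu) • oddSum n nu) g = c lam * classSign lam := by
  rw [Finsupp.sum, map_sum, Finset.sum_apply, Finset.sum_eq_single lam]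
  · rw [map_zsmul, Pi.smul_apply, antisym_oddSum_of_mem hg, smul_eq_mul, mul_one]
  · intro mu _ hne
    rw [map_zsmul, Pi.smul_apply, antisym_oddSum_of_mem_of_ne hg hne, smul_zero]
  · intro h
    rw [Finsupp.notMem_support_iff.1 h]
    simp

theorem coeff_of_expansion {n : ℕ} {a : MonoidAlgebra ℤ (Cover n)} {c : EvenPartition →₀ ℤ}
    (h : spinMk n a = c.sum fun nu k => k • classSum n nu) {nu : EvenPartition} {g : Cover n}
    (hg : g ∈ oddClass n nu) : c nu = classSign nu * antisym n a g := by
  rw [spinMk_sum_classSum, spinMk_eq_iff] at h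
  rw [h, antisym_sum_oddSum c hg, mul_comm (c nu), ← mul_assoc, classSign_mul_self, one_mul]

theorem expansion_unique {n : ℕ} {a : MonoidAlgebra ℤ (Cover n)} {c c' : EvenPartition →₀ ℤ}
    (hc : ∀ nu, c nu ≠ 0 → nu.size + nu.length ≤ n)
    (hc' : ∀ nu, c' nu ≠ 0 → nu.size + nu.length ≤ n)
    (h : spinMk n a = c.sum fun nu k => k • classSum n nu)
    (h' : spinMk n a = c'.sum fun nu k => k • classSum n nu) : c = c' := by
  ext nu
  by_cases hn : nu.size + nu.length ≤ n
  · obtain ⟨g, hg⟩ := oddClass_nonempty_iff.2 hn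
    rw [coeff_of_expansion h hg, coeff_of_expansion h' hg]
  · rw [not_imp_comm.1 (hc nu) hn, not_imp_comm.1 (hc' nu) hn]

theorem exists_expansion {n : ℕ} {a : MonoidAlgebra ℤ (Cover n)}
    (hc : ∀ g h, antisym n a (h * g * h⁻¹) = antisym n a g)
    (hs : ∀ g, antisym n a g ≠ 0 → Equiv.Perm.sign (proj n g) = 1) :
    ∃ c : EvenPartition →₀ ℤ, (∀ nu, c nu ≠ 0 → nu.size + nu.length ≤ n) ∧
      spinMk n a = c.sum fun nu k => k • classSum n nu := by
  classical
  -- The coefficient is read off at one odd-order representative; conjugation invariance makes the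
  -- choice immaterial, and `classSign` converts from the odd-order class to $d_\nu$.
  let f : EvenPartition → ℤ := fun nu =>
    if h : nu.size + nu.length ≤ n then
      classSign nu * antisym n a (oddClass_nonempty_iff.2 h).some else 0
  have hf : ∀ nu, f nu ≠ 0 → nu.size + nu.length ≤ n := fun nu h => by
    by_contra h'
    exact h (dif_neg h')
  let c : EvenPartition →₀ ℤ := Finsupp.ofSupportFinite f
    ((finite_nonempty_oddClass n).subset fun nu h => hf nu h)
  have key : ∀ (nu : EvenPartition) (g : Cover n), g ∈ oddClass n nu →
      c nu * classSign nu = antisym n a g := by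
    intro nu g hg
    have h := oddClass_nonempty_iff.1 ⟨g, hg⟩
    have e : c nu = classSign nu * antisym n a (oddClass_nonempty_iff.2 h).some := dif_pos h
    obtain ⟨k, hk⟩ := isConj_iff.1
      (isConj_of_mem_oddClass (oddClass_nonempty_iff.2 h).some_mem hg)
    rw [e, ← hk, hc, mul_right_comm, classSign_mul_self, one_mul]
  refine ⟨c, hf, ?_⟩
  rw [spinMk_sum_classSum, spinMk_eq_iff]
  ext g
  by_cases hodd : Odd (orderOf (proj n g))
  · rcases odd_orderOf_or hodd with h | h
    · obtain ⟨lam, hl⟩ := exists_mem_oddClass h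
      rw [antisym_sum_oddSum c hl, key lam g hl]
    · obtain ⟨lam, hl⟩ := exists_mem_oddClass h
      have := antisym_sum_oddSum c hl
      rw [key lam _ hl, antisym_z_mul, antisym_z_mul, neg_inj] at this
      exact this.symm
  -- Over permutations of even order the given function vanishes by antisymmetry, and so does every
  -- class sum.
  · rw [not_imp_comm.1 (odd_orderOf_of_antisymm (antisym_z_mul a) hc hs (g := g)) hodd,
      Finsupp.sum, map_sum, Finset.sum_apply]
    refine (Finset.sum_eq_zero fun nu _ => ?_).symm
    rw [map_zsmul, Pi.smul_apply, antisym_oddSum_of_not_odd nu hodd, smul_zero]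

/-! ### Products of class sums -/

open scoped Classical in
/-- The antisymmetrised coefficients of a product of class sums. -/
theorem antisym_oddSum_mul {n : ℕ} (lam mu : EvenPartition) (g : Cover n) :
    antisym n (oddSum n lam * oddSum n mu) g =
      ∑ h, if h ∈ oddClass n lam then antisym n (oddSum n mu) (h⁻¹ * g) else 0 := by
  have : oddSum n lam * oddSum n mu = ∑ h, if h ∈ oddClass n lam then
      MonoidAlgebra.single h 1 * oddSum n mu else 0 := by
    conv_lhs => rw [oddSum, Finset.sum_mul]
    refine Finset.sum_congr rfl fun h _ => ?_
    split_ifs <;> simp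
  rw [this, map_sum, Finset.sum_apply]
  refine Finset.sum_congr rfl fun h _ => ?_
  split_ifs
  · rw [antisym_apply, antisym_apply, MonoidAlgebra.coeff_single_mul_apply,
      MonoidAlgebra.coeff_single_mul_apply, one_mul, one_mul, ← mul_assoc, ← z_comm, mul_assoc]
  · simp

theorem mem_oddClass_conj_iff {n : ℕ} {lam : EvenPartition} {g : Cover n} (h : Cover n) :
    h * g * h⁻¹ ∈ oddClass n lam ↔ g ∈ oddClass n lam := by
  refine ⟨fun hg => ?_, fun hg => oddClass_conj hg h⟩
  have := oddClass_conj hg h⁻¹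
  simpa [mul_assoc] using this

theorem antisym_oddSum_conj {n : ℕ} (lam : EvenPartition) (g h : Cover n) :
    antisym n (oddSum n lam) (h * g * h⁻¹) = antisym n (oddSum n lam) g := by
  classical
  have e : z n * (h * g * h⁻¹) = h * (z n * g) * h⁻¹ := by
    rw [← mul_assoc, ← mul_assoc, z_comm, mul_assoc h]
  rw [antisym_apply, antisym_apply, e, coeff_oddSum, coeff_oddSum, coeff_oddSum, coeff_oddSum]
  exact congrArg₂ (· - ·) (if_congr (mem_oddClass_conj_iff h) rfl rfl)
    (if_congr (mem_oddClass_conj_iff h) rfl rfl)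

theorem antisym_oddSum_mul_conj {n : ℕ} (lam mu : EvenPartition) (g h : Cover n) :
    antisym n (oddSum n lam * oddSum n mu) (h * g * h⁻¹) =
      antisym n (oddSum n lam * oddSum n mu) g := by
  classical
  rw [antisym_oddSum_mul, antisym_oddSum_mul]
  refine (Fintype.sum_equiv (MulAut.conj h).toEquiv _ _ fun k => ?_).symm
  have e : (h * k * h⁻¹)⁻¹ * (h * g * h⁻¹) = h * (k⁻¹ * g) * h⁻¹ := by group
  simp only [MulEquiv.toEquiv_eq_coe, MulEquiv.coe_toEquiv, MulAut.conj_apply,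
    mem_oddClass_conj_iff, e, antisym_oddSum_conj]

theorem proj_of_antisym_oddSum_ne_zero {n : ℕ} {lam : EvenPartition} {g : Cover n}
    (h : antisym n (oddSum n lam) g ≠ 0) : (proj n g).cycleType = lam.1.map (· + 1) := by
  rw [antisym_apply, coeff_oddSum, coeff_oddSum] at h
  by_cases h1 : g ∈ oddClass n lam
  · exact h1.2
  · by_cases h2 : z n * g ∈ oddClass n lam
    · have := h2.2
      rwa [proj_z_mul] at this
    · simp [h1, h2] at h

/-- A nonzero structure constant comes from a factorisation in the symmetric group. -/
theorem exists_factorization {n : ℕ} {lam mu : EvenPartition} {g : Cover n}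
    (h : antisym n (oddSum n lam * oddSum n mu) g ≠ 0) :
    ∃ u v : Equiv.Perm (Fin n), u.cycleType = lam.1.map (· + 1) ∧
      v.cycleType = mu.1.map (· + 1) ∧ u * v = proj n g := by
  classical
  rw [antisym_oddSum_mul] at h
  obtain ⟨k, _, hk⟩ := Finset.exists_ne_zero_of_sum_ne_zero h
  by_cases hk1 : k ∈ oddClass n lam
  · rw [if_pos hk1] at hk
    exact ⟨proj n k, proj n (k⁻¹ * g), hk1.2, proj_of_antisym_oddSum_ne_zero hk, by simp⟩
  · simp [hk1] at hk

theorem sign_of_antisym_ne_zero {n : ℕ} {lam mu : EvenPartition} {g : Cover n}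
    (h : antisym n (oddSum n lam * oddSum n mu) g ≠ 0) : Equiv.Perm.sign (proj n g) = 1 := by
  obtain ⟨u, v, hu, hv, e⟩ := exists_factorization h
  rw [← e, map_mul, sign_of_odd_orderOf (odd_orderOf_proj_of_cycleType hu),
    sign_of_odd_orderOf (odd_orderOf_proj_of_cycleType hv), one_mul]

theorem classSum_mul {n : ℕ} (lam mu : EvenPartition) : classSum n lam * classSum n mu =
    spinMk n ((classSign lam * classSign mu) • (oddSum n lam * oddSum n mu)) := by
  rw [classSum_eq, classSum_eq, smul_mul_smul_comm, map_zsmul, map_mul]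

theorem existsUnique_isExpansion (n : ℕ) (lam mu : EvenPartition) :
    ∃! c : EvenPartition →₀ ℤ, IsExpansion n lam mu c := by
  obtain ⟨c, h1, h2⟩ := exists_expansion
    (a := (classSign lam * classSign mu) • (oddSum n lam * oddSum n mu))
    (fun g h => by
      rw [map_zsmul, Pi.smul_apply, Pi.smul_apply, antisym_oddSum_mul_conj])
    (fun g h => by
      rw [map_zsmul, Pi.smul_apply] at h
      exact sign_of_antisym_ne_zero (right_ne_zero_of_smul h))
  refine ⟨c, ⟨h1, by rw [classSum_mul, h2]⟩, fun c' hc' => ?_⟩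
  exact expansion_unique hc'.1 h1 (by rw [← classSum_mul]; exact hc'.2) h2

theorem isExpansion_structConst (n : ℕ) (lam mu : EvenPartition) :
    ∃ c : EvenPartition →₀ ℤ, IsExpansion n lam mu c ∧ ∀ nu, c nu = structConst n lam mu nu := by
  have h := (existsUnique_isExpansion n lam mu).exists
  exact ⟨h.choose, h.choose_spec, fun nu => by rw [structConst, dif_pos h]⟩

theorem structConst_eq {n : ℕ} (lam mu : EvenPartition) {nu : EvenPartition} {g : Cover n}
    (hg : g ∈ oddClass n nu) : structConst n lam mu nu = classSign nu *
      ((classSign lam * classSign mu) * antisym n (oddSum n lam * oddSum n mu) g) := by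
  obtain ⟨c, ⟨_, h⟩, e⟩ := isExpansion_structConst n lam mu
  rw [← e, coeff_of_expansion (by rw [← classSum_mul]; exact h) hg, map_zsmul, Pi.smul_apply,
    smul_eq_mul]

theorem structConst_ne_zero_le {n : ℕ} {lam mu nu : EvenPartition}
    (h : structConst n lam mu nu ≠ 0) : nu.size + nu.length ≤ n := by
  obtain ⟨c, ⟨h1, _⟩, e⟩ := isExpansion_structConst n lam mu
  exact h1 nu (by rwa [e])

/-! ### Fixed spaces of permutations -/

section FixSpace

variable {α : Type*}

/-- The functions fixed by a permutation. -/
def fixSpace (w : Equiv.Perm α) : Submodule ℚ (α → ℚ) where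
  carrier := {f | ∀ a, f (w a) = f a}
  zero_mem' := by simp
  add_mem' hf hg a := by simp [hf a, hg a]
  smul_mem' c f hf a := by simp [hf a]

theorem inf_fixSpace_le (u v : Equiv.Perm α) : fixSpace u ⊓ fixSpace v ≤ fixSpace (u * v) :=
  fun _ hf a => (hf.1 (v a)).trans (hf.2 a)

theorem eq_of_mem_fixSpace_of_sameCycle {w : Equiv.Perm α} {f : α → ℚ} (hf : f ∈ fixSpace w)
    {a b : α} (h : w.SameCycle a b) : f a = f b := by
  obtain ⟨k, rfl⟩ := h
  have : ∀ (k : ℕ) (a : α), f ((w ^ k) a) = f a := by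
    intro k
    induction k with
    | zero => simp
    | succ k ih => intro a; rw [pow_succ', Equiv.Perm.mul_apply, hf, ih]
  cases k with
  | ofNat k => exact (this k a).symm
  | negSucc k =>
    rw [zpow_negSucc]
    simpa using this (k + 1) ((w ^ (k + 1))⁻¹ a)

/-- Fixed functions are functions on the set of cycles. -/
def fixSpaceEquiv (w : Equiv.Perm α) :
    fixSpace w ≃ₗ[ℚ] (Quotient (Equiv.Perm.SameCycle.setoid w) → ℚ) where
  toFun f q := Quotient.liftOn q f.1 fun _ _ h => eq_of_mem_fixSpace_of_sameCycle f.2 h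
  map_add' f g := by ext q; induction q using Quotient.inductionOn; rfl
  map_smul' c f := by ext q; induction q using Quotient.inductionOn; rfl
  invFun f := ⟨fun a => f ⟦a⟧, fun a => congrArg f (Quotient.sound
    (Equiv.Perm.sameCycle_apply_left.2 (Equiv.Perm.SameCycle.refl w a)))⟩
  left_inv f := rfl
  right_inv f := by ext q; induction q using Quotient.inductionOn; rfl

variable [Fintype α]

theorem card_le_finrank_fixSpace (u v : Equiv.Perm α) :
    Module.finrank ℚ (fixSpace u) + Module.finrank ℚ (fixSpace v) ≤
      Module.finrank ℚ (fixSpace u ⊓ fixSpace v : Submodule ℚ (α → ℚ)) + Fintype.card α := by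
  have h1 := Submodule.finrank_sup_add_finrank_inf_eq (fixSpace u) (fixSpace v)
  have h2 := Submodule.finrank_le (fixSpace u ⊔ fixSpace v)
  rw [Module.finrank_fintype_fun_eq_card] at h2
  omega

variable [DecidableEq α]

theorem card_quotient_sameCycle (w : Equiv.Perm α) :
    Nat.card (Quotient (Equiv.Perm.SameCycle.setoid w)) + w.cycleType.sum =
      Fintype.card α + w.cycleType.card := by
  -- The fibres of `f` are the cycles, including trivial ones: a moved point is labelled by its
  -- cycle factor, a fixed point by itself.
  let f : α → Equiv.Perm α × Option α := fun a => (w.cycleOf a, if w a = a then some a else none)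
  have hker : Equiv.Perm.SameCycle.setoid w = Setoid.ker f := by
    ext a b
    change w.SameCycle a b ↔ f a = f b
    constructor
    · intro h
      by_cases ha : w a = a
      · rw [h.eq_of_left ha]
      · have hb : w b ≠ b := fun hb => ha ((h.apply_eq_self_iff).2 hb)
        simp [f, ha, hb, h.cycleOf_eq]
    · intro h
      simp only [f, Prod.mk.injEq] at h
      by_cases ha : w a = a
      · by_cases hb : w b = b
        · simp only [ha, hb, if_true, Option.some.injEq] at h
          rw [h.2]
        · simp [ha, hb] at h
      · by_cases hb : w b = b
        · simp [ha, hb] at h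
        · have : b ∈ (w.cycleOf a).support := by
            rw [h.1, Equiv.Perm.mem_support_cycleOf_iff]
            exact ⟨Equiv.Perm.SameCycle.refl _ _, Equiv.Perm.mem_support.2 hb⟩
          exact (Equiv.Perm.mem_support_cycleOf_iff.1 this).1
  have hrange : Set.range f =
      ((w.supportᶜ.image fun a => ((1 : Equiv.Perm α), some a)) ∪
        (w.cycleFactorsFinset.image fun c => (c, (none : Option α))) : Finset _) := by
    ext ⟨c, o⟩
    simp only [Set.mem_range, Finset.coe_union, Finset.coe_image, Set.mem_union, Set.mem_image,
      Finset.mem_coe, Finset.mem_compl, Prod.mk.injEq, f]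
    constructor
    · rintro ⟨a, h1, h2⟩
      by_cases ha : w a = a
      · left
        refine ⟨a, by simpa using ha, ?_, by simpa [ha] using h2⟩
        rw [← h1, (Equiv.Perm.cycleOf_eq_one_iff w).2 ha]
      · right
        refine ⟨c, ?_, rfl, by simpa [ha] using h2⟩
        rw [← h1, Equiv.Perm.cycleOf_mem_cycleFactorsFinset_iff, Equiv.Perm.mem_support]
        exact ha
    · rintro (⟨a, h1, h2, h3⟩ | ⟨c', h1, rfl, h3⟩)
      · have ha : w a = a := by simpa using h1
        exact ⟨a, by rw [← h2, (Equiv.Perm.cycleOf_eq_one_iff w).2 ha], by simpa [ha] using h3⟩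
      · obtain ⟨a, ha⟩ := (Equiv.Perm.mem_cycleFactorsFinset_iff.1 h1).1.nonempty_support
        have ha' := Equiv.Perm.mem_cycleFactorsFinset_support_le h1 ha
        refine ⟨a, (Equiv.Perm.cycle_is_cycleOf ha h1).symm, ?_⟩
        rw [if_neg (Equiv.Perm.mem_support.1 ha'), h3]
  rw [hker, Nat.card_congr (Setoid.quotientKerEquivRange f), hrange, Nat.card_coe_set_eq,
    Set.ncard_coe_finset, Finset.card_union_of_disjoint, Finset.card_image_of_injective,
    Finset.card_image_of_injective, Equiv.Perm.sum_cycleType, Finset.card_compl,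
    Equiv.Perm.cycleType_def, Multiset.card_map]
  · have := Finset.card_le_univ w.support
    have e : w.cycleFactorsFinset.val.card = w.cycleFactorsFinset.card := rfl
    omega
  · intro a b h; simpa using h
  · intro a b h; simpa using h
  · rw [Finset.disjoint_left]
    intro x h1 h2
    obtain ⟨a, _, rfl⟩ := Finset.mem_image.1 h1
    obtain ⟨c, _, h⟩ := Finset.mem_image.1 h2
    simp at h

theorem finrank_fixSpace (w : Equiv.Perm α) :
    Module.finrank ℚ (fixSpace w) + w.cycleType.sum = Fintype.card α + w.cycleType.card := by
  classical
  have : Finite (Quotient (Equiv.Perm.SameCycle.setoid w)) := Quotient.finite _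
  have := Fintype.ofFinite (Quotient (Equiv.Perm.SameCycle.setoid w))
  rw [(fixSpaceEquiv w).finrank_eq, Module.finrank_fintype_fun_eq_card, ← Nat.card_eq_fintype_card,
    card_quotient_sameCycle]

theorem finrank_fixSpace_of_cycleType {w : Equiv.Perm α} {lam : EvenPartition}
    (h : w.cycleType = lam.1.map (· + 1)) :
    Module.finrank ℚ (fixSpace w) + lam.size = Fintype.card α := by
  have := finrank_fixSpace w
  rw [h, lam.sum_map, Multiset.card_map] at this
  have e : lam.length = Multiset.card lam.1 := rfl
  omega

/-! ### Size and length bounds for factorisations in the symmetric group -/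

variable {u v : Equiv.Perm α} {lam mu nu : EvenPartition}

/-- Size is the codimension of the fixed space, and
$\mathrm{Fix}(uv)\supseteq\mathrm{Fix}(u)\cap\mathrm{Fix}(v)$. -/
theorem size_le_of_mul (hu : u.cycleType = lam.1.map (· + 1)) (hv : v.cycleType = mu.1.map (· + 1))
    (h : (u * v).cycleType = nu.1.map (· + 1)) : nu.size ≤ lam.size + mu.size := by
  have h1 := finrank_fixSpace_of_cycleType hu
  have h2 := finrank_fixSpace_of_cycleType hv
  have h3 := finrank_fixSpace_of_cycleType h
  have h4 := card_le_finrank_fixSpace u v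
  have h5 := Submodule.finrank_mono (inf_fixSpace_le u v)
  omega

/-- Equality of dimensions forces $\mathrm{Fix}(uv)=\mathrm{Fix}(u)\cap\mathrm{Fix}(v)$. The
indicator of a point fixed by $uv$ is then fixed by $u$. -/
theorem fixed_of_size_eq (hu : u.cycleType = lam.1.map (· + 1))
    (hv : v.cycleType = mu.1.map (· + 1)) (h : (u * v).cycleType = nu.1.map (· + 1))
    (hs : nu.size = lam.size + mu.size) {a : α} (ha : (u * v) a = a) : u a = a := by
  have h1 := finrank_fixSpace_of_cycleType hu
  have h2 := finrank_fixSpace_of_cycleType hv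
  have h3 := finrank_fixSpace_of_cycleType h
  have h4 := card_le_finrank_fixSpace u v
  have h5 := Submodule.eq_of_le_of_finrank_le (inf_fixSpace_le u v) (by omega)
  have h6 : (Pi.single a 1 : α → ℚ) ∈ fixSpace (u * v) := by
    intro b
    by_cases hb : b = a
    · rw [hb, ha]
    · have hb' : (u * v) b ≠ a := fun e => hb ((u * v).injective (e.trans ha.symm))
      rw [Pi.single_eq_of_ne hb', Pi.single_eq_of_ne hb]
  rw [← h5] at h6
  have h7 := h6.1 a
  by_contra hne
  rw [Pi.single_eq_of_ne hne, Pi.single_eq_same] at h7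
  exact zero_ne_one h7

theorem disjoint_of_sum_cycleType_le
    (h : u.cycleType.sum + v.cycleType.sum ≤ (u * v).cycleType.sum) : u.Disjoint v := by
  rw [Equiv.Perm.sum_cycleType, Equiv.Perm.sum_cycleType, Equiv.Perm.sum_cycleType] at h
  have h1 := Finset.card_le_card (Equiv.Perm.support_mul_le u v)
  have h2 := Finset.card_union_add_card_inter u.support v.support
  rw [Equiv.Perm.disjoint_iff_disjoint_support, Finset.disjoint_iff_inter_eq_empty,
    ← Finset.card_eq_zero]
  simp only [Finset.sup_eq_union] at h1
  omega

/-- The sum of the cycle lengths, size plus length, is the cardinality of the support, which is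
subadditive; the sizes cancel. -/
theorem length_le_of_size_eq (hu : u.cycleType = lam.1.map (· + 1))
    (hv : v.cycleType = mu.1.map (· + 1)) (h : (u * v).cycleType = nu.1.map (· + 1))
    (hs : nu.size = lam.size + mu.size) : nu.length ≤ lam.length + mu.length := by
  have h1 := Finset.card_le_card (Equiv.Perm.support_mul_le u v)
  have h2 := Finset.card_union_le u.support v.support
  rw [← Equiv.Perm.sum_cycleType, h, nu.sum_map] at h1
  rw [← Equiv.Perm.sum_cycleType, ← Equiv.Perm.sum_cycleType, hu, hv, lam.sum_map,
    mu.sum_map] at h2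
  simp only [Finset.sup_eq_union] at h1
  omega

theorem eq_add_of_length_eq (hu : u.cycleType = lam.1.map (· + 1))
    (hv : v.cycleType = mu.1.map (· + 1)) (h : (u * v).cycleType = nu.1.map (· + 1))
    (hs : nu.size = lam.size + mu.size) (hl : lam.length + mu.length ≤ nu.length) :
    nu.1 = lam.1 + mu.1 := by
  have hd : u.Disjoint v := disjoint_of_sum_cycleType_le (by
    rw [hu, hv, h, lam.sum_map, mu.sum_map, nu.sum_map]; omega)
  have e := hd.cycleType_mul
  rw [h, hu, hv, ← Multiset.map_add] at e
  exact Multiset.map_injective (add_left_injective 1) e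

end FixSpace

/-! ### Top degree structure constants -/

theorem exists_factorization_of_structConst {n : ℕ} {lam mu nu : EvenPartition}
    (h : structConst n lam mu nu ≠ 0) :
    ∃ u v : Equiv.Perm (Fin n), u.cycleType = lam.1.map (· + 1) ∧
      v.cycleType = mu.1.map (· + 1) ∧ (u * v).cycleType = nu.1.map (· + 1) := by
  obtain ⟨g, hg⟩ := oddClass_nonempty_iff.2 (structConst_ne_zero_le h)
  rw [structConst_eq lam mu hg] at h
  obtain ⟨u, v, hu, hv, e⟩ :=
    exists_factorization (right_ne_zero_of_mul (right_ne_zero_of_mul h))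
  exact ⟨u, v, hu, hv, by rw [e, hg.2]⟩

theorem size_le_of_structConst {n : ℕ} {lam mu nu : EvenPartition}
    (h : structConst n lam mu nu ≠ 0) : nu.size ≤ lam.size + mu.size := by
  obtain ⟨u, v, hu, hv, e⟩ := exists_factorization_of_structConst h
  exact size_le_of_mul hu hv e

theorem antisym_oddSum_incl {n : ℕ} (mu : EvenPartition) (g : Cover n) :
    antisym (n + 1) (oddSum (n + 1) mu) (incl n g) = antisym n (oddSum n mu) g := by
  classical
  rw [antisym_apply, antisym_apply, coeff_oddSum, coeff_oddSum, coeff_oddSum, coeff_oddSum,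
    ← incl_z, ← map_mul]
  exact congrArg₂ (· - ·) (if_congr incl_mem_oddClass rfl rfl)
    (if_congr incl_mem_oddClass rfl rfl)

/-- In top degree, factors of a permutation fixing the last point fix it too, so every contributing
term already lives in the smaller cover. -/
theorem antisym_mul_incl {n : ℕ} {lam mu nu : EvenPartition} (hs : nu.size = lam.size + mu.size)
    {g : Cover n} (hg : g ∈ oddClass n nu) :
    antisym (n + 1) (oddSum (n + 1) lam * oddSum (n + 1) mu) (incl n g) =
      antisym n (oddSum n lam * oddSum n mu) g := by
  classical
  rw [antisym_oddSum_mul, antisym_oddSum_mul]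
  symm
  refine Finset.sum_of_injOn (incl n) (incl_injective n).injOn (by simp [Set.MapsTo])
    (fun h _ hh => ?_) (fun h _ => ?_)
  · split_ifs with h1
    · by_contra hne
      refine hh ?_
      have h2 := proj_of_antisym_oddSum_ne_zero hne
      have h3 : proj (n + 1) h * proj (n + 1) (h⁻¹ * incl n g) = emb n (proj n g) := by
        rw [← map_mul, mul_inv_cancel_left, proj_incl]
      have h4 := fixed_of_size_eq h1.2 h2 (by rw [h3, cycleType_emb, hg.2]) hs
        (a := Fin.last n) (by rw [h3, emb_last])
      obtain ⟨k, hk⟩ := mem_range_incl h4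
      exact ⟨k, by simp, hk⟩
    · rfl
  · rw [← map_inv, ← map_mul, antisym_oddSum_incl]
    exact if_congr incl_mem_oddClass.symm rfl rfl

theorem structConst_eq_topConst {lam mu nu : EvenPartition} (hs : nu.size = lam.size + mu.size)
    {n : ℕ} (hn : nu.size + nu.length ≤ n) :
    structConst n lam mu nu = topConst lam mu nu := by
  induction n, hn using Nat.le_induction with
  | base => rfl
  | succ n hn ih =>
    obtain ⟨g, hg⟩ := oddClass_nonempty_iff.2 hn
    rw [← ih, structConst_eq lam mu hg, structConst_eq lam mu (incl_mem_oddClass.2 hg),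
      antisym_mul_incl hs hg]

theorem length_le_of_topConst {lam mu nu : EvenPartition} (hs : nu.size = lam.size + mu.size)
    (h : topConst lam mu nu ≠ 0) : nu.length ≤ lam.length + mu.length := by
  obtain ⟨u, v, hu, hv, e⟩ := exists_factorization_of_structConst h
  exact length_le_of_size_eq hu hv e hs

theorem eq_add_of_topConst {lam mu nu : EvenPartition} (hs : nu.size = lam.size + mu.size)
    (h : topConst lam mu nu ≠ 0) (hl : lam.length + mu.length ≤ nu.length) :
    nu.1 = lam.1 + mu.1 := by
  obtain ⟨u, v, hu, hv, e⟩ := exists_factorization_of_structConst h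
  exact eq_add_of_length_eq hu hv e hs hl

/-- The factors have supports too small to overlap, so they commute and the product of their
odd-order lifts is the odd-order lift. All terms are therefore nonnegative, and the given
factorisation contributes a term $1$. -/
theorem antisym_mul_pos {n : ℕ} {lam mu nu : EvenPartition} (hnu : nu.1 = lam.1 + mu.1)
    {g : Cover n} (hg : g ∈ oddClass n nu) {u v : Equiv.Perm (Fin n)}
    (hu : u.cycleType = lam.1.map (· + 1)) (hv : v.cycleType = mu.1.map (· + 1))
    (huv : u * v = proj n g) : 0 < antisym n (oddSum n lam * oddSum n mu) g := by
  classical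
  have hmap : nu.1.map (· + 1) = lam.1.map (· + 1) + mu.1.map (· + 1) := by
    rw [hnu, Multiset.map_add]
  have split : ∀ h k : Cover n, h ∈ oddClass n lam → k ∈ oddClass n mu →
      proj n h * proj n k = proj n g → h * k = g := by
    intro h k hh hk e
    have hd : (proj n h).Disjoint (proj n k) := disjoint_of_sum_cycleType_le (by
      rw [e, hh.2, hk.2, hg.2, hmap, Multiset.sum_add])
    exact eq_of_odd_orderOf (by rw [map_mul, e]) (odd_orderOf_mul hd.commute hh.1 hk.1) hg.1
  rw [antisym_oddSum_mul]
  refine Finset.sum_pos' (fun h _ => ?_) ?_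
  · split_ifs with h1
    · by_cases h2 : h⁻¹ * g ∈ oddClass n mu
      · rw [antisym_oddSum_of_mem h2]; exact zero_le_one
      · rw [antisym_apply, coeff_oddSum, coeff_oddSum, if_neg h2, if_neg, sub_zero]
        intro h3
        -- A negative term would need $z h^{-1}g$ of odd order; multiplying by $h$ then gives
        -- $zg=g$.
        have h4 := split h _ h1 h3 (by rw [proj_z_mul, ← map_mul, mul_inv_cancel_left])
        rw [← mul_assoc, ← z_comm, mul_assoc, mul_inv_cancel_left] at h4
        exact z_mul_ne g h4
    · exact le_rfl
  · obtain ⟨h, rfl, ho⟩ := exists_odd_lift (odd_orderOf_proj_of_cycleType hu)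
    obtain ⟨k, rfl, ko⟩ := exists_odd_lift (odd_orderOf_proj_of_cycleType hv)
    have e := split h k ⟨ho, hu⟩ ⟨ko, hv⟩ huv
    refine ⟨h, Finset.mem_univ _, ?_⟩
    have hk : k ∈ oddClass n mu := ⟨ko, hv⟩
    rw [if_pos ⟨ho, hu⟩, ← e, inv_mul_cancel_left, antisym_oddSum_of_mem hk]
    exact zero_lt_one

theorem classSign_ne_zero (lam : EvenPartition) : classSign lam ≠ 0 := by
  intro h
  have := classSign_mul_self lam
  rw [h] at this
  simp at this

/-- Splitting one cycle of length $2(k+1)+1$ off a permutation of type $\nu$ supplies the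
factorisation required for positivity. -/
theorem topConst_onePart_ne_zero (k : ℕ) (lam nu : EvenPartition)
    (hnu : nu.1 = (EvenPartition.onePart k).1 + lam.1) :
    topConst (EvenPartition.onePart k) lam nu ≠ 0 := by
  obtain ⟨g, hg⟩ := oddClass_nonempty_iff.2 (le_refl (nu.size + nu.length))
  have hct : (proj _ g).cycleType = {2 * (k + 1) + 1} + lam.1.map (· + 1) := by
    rw [hg.2, hnu, Multiset.map_add]; rfl
  have hm : 2 * (k + 1) + 1 ∈ (proj _ g).cycleType := by rw [hct]; simp
  obtain ⟨c, r, hcr, hdis, hcyc, hcard⟩ := Equiv.Perm.mem_cycleType_iff.1 hm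
  have hc : c.cycleType = (EvenPartition.onePart k).1.map (· + 1) := by
    rw [hcyc.cycleType, hcard]; rfl
  have hr : r.cycleType = lam.1.map (· + 1) := by
    rw [hcr, hdis.cycleType_mul, hcyc.cycleType, hcard] at hct
    exact add_left_cancel hct
  rw [topConst, structConst_eq _ _ hg]
  exact mul_ne_zero (classSign_ne_zero _) (mul_ne_zero (mul_ne_zero (classSign_ne_zero _)
    (classSign_ne_zero _)) (antisym_mul_pos hnu hg hc hr hcr.symm).ne')

/-! ### Coefficients in the graded algebra -/

/-- The coefficient of `d_ν`. -/
def FH.coef (nu : EvenPartition) : FH →+ ℤ :=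
  (Finsupp.applyAddHom nu : (EvenPartition →₀ ℤ) →+ ℤ)

/-- The coefficients with respect to the basis `d_ν`. -/
def FH.coefs (a : FH) : EvenPartition →₀ ℤ := a

theorem FH.coefs_apply (a : FH) (nu : EvenPartition) : FH.coefs a nu = FH.coef nu a := rfl

theorem FH.ext_coef {a b : FH} (h : ∀ nu, FH.coef nu a = FH.coef nu b) : a = b :=
  Finsupp.ext h

theorem FH.coef_d_self (nu : EvenPartition) : FH.coef nu (FH.d nu) = 1 :=
  Finsupp.single_eq_same

theorem FH.coef_d_of_ne {lam nu : EvenPartition} (h : lam ≠ nu) : FH.coef nu (FH.d lam) = 0 :=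
  Finsupp.single_eq_of_ne h.symm

/-- The even partition underlying an element of the index set of `FH.basisMul`. -/
def EvenPartition.ofPartition {m : ℕ} (p : {p : Nat.Partition m // ∀ i ∈ p.parts, Even i}) :
    EvenPartition := ⟨p.1.parts, fun i hi => ⟨p.1.parts_pos hi, p.2 i hi⟩⟩

theorem EvenPartition.size_ofPartition {m : ℕ}
    (p : {p : Nat.Partition m // ∀ i ∈ p.parts, Even i}) :
    (EvenPartition.ofPartition p).size = m := p.1.parts_sum

theorem EvenPartition.ofPartition_injective {m : ℕ} :
    Function.Injective (EvenPartition.ofPartition (m := m)) := fun _ _ h =>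
  Subtype.ext (Nat.Partition.ext (congrArg Subtype.val h))

/-- An even partition as an element of the index set of `FH.basisMul`. -/
def EvenPartition.toPartition {m : ℕ} (nu : EvenPartition) (h : nu.size = m) :
    {p : Nat.Partition m // ∀ i ∈ p.parts, Even i} :=
  ⟨⟨nu.1, fun hi => (nu.2 _ hi).1, h⟩, fun i hi => (nu.2 i hi).2⟩

theorem EvenPartition.ofPartition_toPartition {m : ℕ} (nu : EvenPartition) (h : nu.size = m) :
    EvenPartition.ofPartition (nu.toPartition h) = nu := rfl

theorem FH.basisMul_eq (lam mu : EvenPartition) : FH.basisMul lam mu =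
    ∑ p, topConst lam mu (EvenPartition.ofPartition (m := lam.size + mu.size) p) •
      FH.d (EvenPartition.ofPartition p) := rfl

theorem FH.coef_basisMul {lam mu nu : EvenPartition} (h : nu.size = lam.size + mu.size) :
    FH.coef nu (FH.basisMul lam mu) = topConst lam mu nu := by
  rw [FH.basisMul_eq, map_sum, Finset.sum_eq_single (nu.toPartition h)]
  · rw [map_zsmul, EvenPartition.ofPartition_toPartition, FH.coef_d_self, smul_eq_mul, mul_one]
  · intro p _ hp
    rw [map_zsmul, FH.coef_d_of_ne, smul_zero]
    exact fun e => hp (EvenPartition.ofPartition_injective e)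
  · simp

theorem FH.coef_basisMul_of_ne {lam mu nu : EvenPartition} (h : nu.size ≠ lam.size + mu.size) :
    FH.coef nu (FH.basisMul lam mu) = 0 := by
  rw [FH.basisMul_eq, map_sum]
  refine Finset.sum_eq_zero fun p _ => ?_
  rw [map_zsmul, FH.coef_d_of_ne, smul_zero]
  rintro rfl
  exact h (EvenPartition.size_ofPartition p)

theorem FH.d_mul_d (lam mu : EvenPartition) : FH.d lam * FH.d mu = FH.basisMul lam mu := by
  change FH.mul (FH.d lam) (FH.d mu) = _
  unfold FH.mul FH.d
  rw [Finsupp.sum_single_index, Finsupp.sum_single_index]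
  · simp
  · simp
  · simp [Finsupp.sum]

theorem FH.closure_range_d : AddSubgroup.closure (Set.range FH.d) = ⊤ := by
  rw [eq_top_iff]
  intro a _
  have : ∀ a : EvenPartition →₀ ℤ, (show FH from a) ∈ AddSubgroup.closure (Set.range FH.d) := by
    intro a
    induction a using Finsupp.induction_linear with
    | zero => exact zero_mem _
    | add a b ha hb => exact add_mem ha hb
    | single lam k =>
      have e : (show FH from Finsupp.single lam k) = k • FH.d lam := by
        refine FH.ext_coef fun nu => ?_
        rw [map_zsmul]
        change (Finsupp.single lam k) nu = k • (Finsupp.single lam (1 : ℤ)) nu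
        simp [Finsupp.single_apply]
      rw [e]
      exact zsmul_mem (AddSubgroup.subset_closure (Set.mem_range_self lam)) k
  exact this a

theorem FH.induction {P : FH → Prop} (zero : P 0) (add : ∀ a b, P a → P b → P (a + b))
    (neg : ∀ a, P a → P (-a)) (d : ∀ lam, P (FH.d lam)) (a : FH) : P a := by
  have h : a ∈ AddSubgroup.closure (Set.range FH.d) := by
    rw [FH.closure_range_d]; trivial
  induction h using AddSubgroup.closure_induction with
  | mem a h =>
    obtain ⟨lam, e⟩ := h
    exact e ▸ d lam
  | zero => exact zero
  | add a b _ _ ha hb => exact add a b ha hb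
  | neg a _ ha => exact neg a ha

/-! ### Commutativity -/

theorem oddSum_mul_comm {n : ℕ} (lam : EvenPartition) (a : MonoidAlgebra ℤ (Cover n)) :
    oddSum n lam * a = a * oddSum n lam := by
  classical
  induction a using MonoidAlgebra.induction_linear with
  | zero => simp
  | add a b ha hb => rw [mul_add, ha, hb, add_mul]
  | single h r =>
    ext g
    rw [MonoidAlgebra.coeff_mul_single_apply, MonoidAlgebra.coeff_single_mul_apply, coeff_oddSum,
      coeff_oddSum, mul_comm]
    refine congrArg (r * ·) (if_congr ?_ rfl rfl)
    rw [← mem_oddClass_conj_iff h⁻¹]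
    simp [mul_assoc]

theorem classSum_comm {n : ℕ} (lam mu : EvenPartition) :
    classSum n lam * classSum n mu = classSum n mu * classSum n lam := by
  rw [classSum_mul, classSum_mul, oddSum_mul_comm, mul_comm (classSign lam)]

theorem topConst_comm (lam mu nu : EvenPartition) : topConst lam mu nu = topConst mu lam nu := by
  obtain ⟨g, hg⟩ := oddClass_nonempty_iff.2 (le_refl (nu.size + nu.length))
  rw [topConst, topConst, structConst_eq _ _ hg, structConst_eq _ _ hg, oddSum_mul_comm,
    mul_comm (classSign lam)]

theorem FH.basisMul_comm (lam mu : EvenPartition) : FH.basisMul lam mu = FH.basisMul mu lam := by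
  refine FH.ext_coef fun nu => ?_
  by_cases h : nu.size = lam.size + mu.size
  · rw [FH.coef_basisMul h, FH.coef_basisMul (h.trans (add_comm _ _)), topConst_comm]
  · rw [FH.coef_basisMul_of_ne h, FH.coef_basisMul_of_ne (fun e => h (e.trans (add_comm _ _)))]

theorem FH.mul_comm' (a b : FH) : a * b = b * a := by
  induction a using FH.induction with
  | zero => rw [zero_mul, mul_zero]
  | add a a' ha ha' => rw [add_mul, mul_add, ha, ha']
  | neg a ha => rw [neg_mul, mul_neg, ha]
  | d lam =>
    induction b using FH.induction with
    | zero => rw [zero_mul, mul_zero]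
    | add b b' hb hb' => rw [add_mul, mul_add, hb, hb']
    | neg b hb => rw [neg_mul, mul_neg, hb]
    | d mu => rw [FH.d_mul_d, FH.d_mul_d, FH.basisMul_comm]

/-! ### Associativity -/

/-- The antisymmetrised coefficient at `g`, on the spin group algebra. -/
def spinCoeff (n : ℕ) (g : Cover n) : SpinAlgebra n →+ ℤ where
  -- Any preimage serves: the value depends only on the image, by `spinMk_eq_iff`.
  toFun s := antisym n (Function.surjInv (spinIdeal n).ringCon.mk'_surjective s) g
  map_zero' := by
    rw [spinMk_eq_iff.1 ((Function.surjInv_eq (spinIdeal n).ringCon.mk'_surjective 0).trans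
      (map_zero (spinMk n)).symm)]
    simp
  map_add' s s' := by
    have h := Function.surjInv_eq (spinIdeal n).ringCon.mk'_surjective
    rw [← Pi.add_apply, ← map_add]
    refine congrFun (spinMk_eq_iff.1 ?_) g
    rw [map_add]
    exact (h _).trans (congrArg₂ (· + ·) (h s) (h s')).symm

theorem spinCoeff_spinMk {n : ℕ} (g : Cover n) (a : MonoidAlgebra ℤ (Cover n)) :
    spinCoeff n g (spinMk n a) = antisym n a g :=
  congrFun (spinMk_eq_iff.1 (Function.surjInv_eq (spinIdeal n).ringCon.mk'_surjective _)) g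

theorem spinCoeff_classSum_mul {n : ℕ} (lam mu : EvenPartition) {nu : EvenPartition} {g : Cover n}
    (hg : g ∈ oddClass n nu) : spinCoeff n g (classSum n lam * classSum n mu) =
      classSign nu * structConst n lam mu nu := by
  rw [classSum_mul, spinCoeff_spinMk, structConst_eq lam mu hg, ← mul_assoc, classSign_mul_self,
    one_mul, map_zsmul, Pi.smul_apply, smul_eq_mul]

theorem EvenPartition.length_le_size (lam : EvenPartition) : lam.length ≤ lam.size := by
  have := Multiset.card_nsmul_le_sum (s := lam.1) (a := 1) (fun p hp => (lam.2 p hp).1)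
  simpa [EvenPartition.length, EvenPartition.size] using this

theorem FH.coef_mul_d (a : FH) (kap rho : EvenPartition) : FH.coef rho (a * FH.d kap) =
    (FH.coefs a).sum fun nu k => k * FH.coef rho (FH.basisMul nu kap) := by
  induction a using FH.induction with
  | zero => rw [zero_mul, map_zero]; exact Finsupp.sum_zero_index.symm
  | add a b ha hb =>
    rw [add_mul, map_add, ha, hb]
    exact (Finsupp.sum_add_index' (by simp) (by intros; ring)).symm
  | neg a ha =>
    rw [neg_mul, map_neg, ha]
    refine Eq.trans ?_ (Finsupp.sum_neg_index (by simp)).symm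
    simp [Finsupp.sum]
    rfl
  | d lam =>
    rw [FH.d_mul_d]
    refine Eq.trans ?_ (Finsupp.sum_single_index (by simp)).symm
    simp

theorem FH.coef_mul_mul_of_ne {lam mu kap rho : EvenPartition}
    (h : rho.size ≠ lam.size + mu.size + kap.size) :
    FH.coef rho (FH.d lam * FH.d mu * FH.d kap) = 0 := by
  rw [FH.coef_mul_d, FH.d_mul_d]
  refine Finset.sum_eq_zero fun nu _ => ?_
  change FH.coef nu (FH.basisMul lam mu) * FH.coef rho (FH.basisMul nu kap) = 0
  by_cases h1 : nu.size = lam.size + mu.size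
  · rw [FH.coef_basisMul_of_ne (nu := rho) (fun e => h (by rw [e, h1])), mul_zero]
  · rw [FH.coef_basisMul_of_ne h1, zero_mul]

/-- Used to compare the graded product with the full expansion in $S_n$, whose supports may differ:
only the products of coefficients must agree. -/
theorem sum_mul_congr {ι : Type*} {b c : ι →₀ ℤ} {F G : ι → ℤ} (h : ∀ i, b i * F i = c i * G i) :
    (b.sum fun i k => k * F i) = c.sum fun i k => k * G i := by
  classical
  rw [Finsupp.sum_of_support_subset b (s := b.support ∪ c.support) Finset.subset_union_left _
    (by simp), Finsupp.sum_of_support_subset c (s := b.support ∪ c.support)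
    Finset.subset_union_right _ (by simp)]
  exact Finset.sum_congr rfl fun i _ => h i

/-- Since $\ell\le$ size, the bound $2|\rho|\le n$ puts every top-degree constant involved in its
stable range. Lower-degree terms of the first product cannot reach degree $|\rho|$ after the second.
-/
theorem FH.coef_mul_mul {n : ℕ} {lam mu kap rho : EvenPartition}
    (h : rho.size = lam.size + mu.size + kap.size) (hn : 2 * rho.size ≤ n) {g : Cover n}
    (hg : g ∈ oddClass n rho) : FH.coef rho (FH.d lam * FH.d mu * FH.d kap) =
      classSign rho * spinCoeff n g (classSum n lam * classSum n mu * classSum n kap) := by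
  classical
  obtain ⟨c, ⟨_, hc⟩, e⟩ := isExpansion_structConst n lam mu
  have hr : rho.size + rho.length ≤ n := by have := rho.length_le_size; omega
  have e1 : classSign rho * spinCoeff n g (classSum n lam * classSum n mu * classSum n kap) =
      c.sum fun nu k => k * structConst n nu kap rho := by
    rw [hc, Finsupp.sum, Finset.sum_mul, map_sum, Finset.mul_sum]
    refine Finset.sum_congr rfl fun nu _ => ?_
    rw [smul_mul_assoc, map_zsmul, spinCoeff_classSum_mul nu kap hg, smul_eq_mul,
      mul_left_comm (classSign rho), ← mul_assoc (classSign rho), classSign_mul_self, one_mul]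
  rw [e1, FH.coef_mul_d, FH.d_mul_d]
  refine sum_mul_congr fun nu => ?_
  rw [FH.coefs_apply]
  by_cases h1 : nu.size = lam.size + mu.size
  · have h2 : rho.size = nu.size + kap.size := by rw [h1, h]
    rw [FH.coef_basisMul h1, e, FH.coef_basisMul h2, structConst_eq_topConst h2 hr, structConst_eq_topConst h1 (by
      have := nu.length_le_size; omega)]
  · rw [FH.coef_basisMul_of_ne h1, zero_mul, e]
    -- A nonzero term would give $|\nu|\le|\lambda|+|\mu|$ and $|\rho|\le|\nu|+|\kappa|$, which
    -- together force $|\nu|=|\lambda|+|\mu|$.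
    by_contra hne
    have h4 := size_le_of_structConst (left_ne_zero_of_mul (Ne.symm hne))
    have h5 := size_le_of_structConst (right_ne_zero_of_mul (Ne.symm hne))
    omega

/-- Commutativity brings both sides to left-bracketed form; top coefficients of both are then read
off from one triple product in the associative spin algebra. -/
theorem FH.d_mul_assoc (lam mu kap : EvenPartition) :
    FH.d lam * FH.d mu * FH.d kap = FH.d lam * (FH.d mu * FH.d kap) := by
  rw [FH.mul_comm' (FH.d lam) (FH.d mu * FH.d kap)]
  refine FH.ext_coef fun rho => ?_
  by_cases h : rho.size = lam.size + mu.size + kap.size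
  · have h' : rho.size = mu.size + kap.size + lam.size := by omega
    obtain ⟨g, hg⟩ := oddClass_nonempty_iff.2 (show rho.size + rho.length ≤ 2 * rho.size by
      have := rho.length_le_size; omega)
    rw [FH.coef_mul_mul h le_rfl hg, FH.coef_mul_mul h' le_rfl hg,
      mul_assoc (classSum _ mu), classSum_comm kap lam, ← mul_assoc (classSum _ mu),
      classSum_comm mu lam]
  · rw [FH.coef_mul_mul_of_ne h, FH.coef_mul_mul_of_ne (fun e => h (by omega))]

theorem FH.mul_assoc' (a b c : FH) : a * b * c = a * (b * c) := by
  induction a using FH.induction with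
  | zero => simp only [zero_mul]
  | add a a' ha ha' => simp only [add_mul, ha, ha']
  | neg a ha => simp only [neg_mul, ha]
  | d lam =>
    induction b using FH.induction with
    | zero => simp only [zero_mul, mul_zero]
    | add b b' hb hb' => simp only [add_mul, mul_add, hb, hb']
    | neg b hb => simp only [neg_mul, mul_neg, hb]
    | d mu =>
      induction c using FH.induction with
      | zero => simp only [mul_zero]
      | add c c' hc hc' => simp only [mul_add, hc, hc']
      | neg c hc => simp only [mul_neg, hc]
      | d kap => exact FH.d_mul_assoc lam mu kap

/-! ### The unit -/

theorem oddClass_empty (n : ℕ) (g : Cover n) : g ∈ oddClass n EvenPartition.empty ↔ g = 1 := by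
  constructor
  · rintro ⟨h1, h2⟩
    have h3 : proj n g = 1 := Equiv.Perm.cycleType_eq_zero.1 h2
    exact eq_of_odd_orderOf (h3.trans (map_one _).symm) h1 (by simp)
  · rintro rfl
    exact ⟨by simp, by rw [map_one, Equiv.Perm.cycleType_one]; rfl⟩

theorem oddSum_empty (n : ℕ) : oddSum n EvenPartition.empty = 1 := by
  classical
  ext g
  rw [coeff_oddSum, MonoidAlgebra.one_def, MonoidAlgebra.coeff_single, Finsupp.single_apply]
  exact if_congr ((oddClass_empty n g).trans eq_comm) rfl rfl

theorem classSign_empty : classSign EvenPartition.empty = 1 := by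
  refine if_pos ?_
  have : tElem (EvenPartition.empty.size + EvenPartition.empty.length) EvenPartition.empty = 1 := by
    change blockCycles _ 0 (Multiset.sort 0 _) = 1
    rw [Multiset.sort_zero]
    rfl
  rw [this]
  simp

theorem FH.basisMul_empty (mu : EvenPartition) :
    FH.basisMul EvenPartition.empty mu = FH.d mu := by
  have h0 : EvenPartition.empty.size = 0 := rfl
  refine FH.ext_coef fun nu => ?_
  by_cases h : nu.size = EvenPartition.empty.size + mu.size
  · obtain ⟨g, hg⟩ := oddClass_nonempty_iff.2 (le_refl (nu.size + nu.length))
    rw [FH.coef_basisMul h, topConst, structConst_eq _ _ hg, oddSum_empty, classSign_empty,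
      one_mul, one_mul]
    by_cases e : mu = nu
    · subst e
      rw [FH.coef_d_self, antisym_oddSum_of_mem hg, mul_one, classSign_mul_self]
    · rw [FH.coef_d_of_ne e, antisym_oddSum_of_mem_of_ne hg e, mul_zero, mul_zero]
  · rw [FH.coef_basisMul_of_ne h, FH.coef_d_of_ne (fun e => h (by rw [e, h0, zero_add]))]

theorem FH.one_mul' (a : FH) : FH.d EvenPartition.empty * a = a := by
  induction a using FH.induction with
  | zero => rw [mul_zero]
  | add a b ha hb => rw [mul_add, ha, hb]
  | neg a ha => rw [mul_neg, ha]
  | d mu => rw [FH.d_mul_d, FH.basisMul_empty]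

/-- The commutative ring structure on `F`. -/
abbrev FH.commRing : CommRing FH :=
  { (inferInstance : NonUnitalNonAssocRing FH) with
    mul_assoc := FH.mul_assoc'
    mul_comm := FH.mul_comm'
    one := FH.d EvenPartition.empty
    one_mul := FH.one_mul'
    mul_one := fun a => (FH.mul_comm' a _).trans (FH.one_mul' a) }

attribute [local instance] FH.commRing

/-! ### Triangular maps between free modules -/

section Triangular

variable {K V W ι : Type*} [Field K] [AddCommGroup V] [Module K V] [AddCommGroup W] [Module K W]

/-- A linear map that is triangular with nonzero diagonal with respect to bases graded by natural
numbers is bijective. -/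
theorem bijective_of_triangular (b : Module.Basis ι K V) (b' : Module.Basis ι K W) (len : ι → ℕ)
    (L : V →ₗ[K] W) (c : ι → K) (hc : ∀ i, c i ≠ 0)
    (h : ∀ i, L (b i) - c i • b' i ∈ Submodule.span K (b' '' {j | len j < len i})) :
    Function.Bijective L := by
  constructor
  · rw [injective_iff_map_eq_zero]
    intro v hv
    by_contra hne
    have hs : (b.repr v).support.Nonempty := by
      rw [Finsupp.support_nonempty_iff]
      exact fun h0 => hne (b.repr.map_eq_zero_iff.1 h0)
    -- At an index of maximal length in the support, no other basis vector of the support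
    -- contributes to the $i$-th coordinate, so only the diagonal term survives.
    obtain ⟨i, hi, hmax⟩ := Finset.exists_max_image _ len hs
    have key : ∀ j, len j ≤ len i → j ≠ i → b'.repr (L (b j)) i = 0 := by
      intro j hj hji
      have h1 : b'.repr (L (b j) - c j • b' j) i = 0 := by
        have := h j
        rw [Module.Basis.mem_span_image] at this
        by_contra h2
        have h3 := this (Finset.mem_coe.2 (Finsupp.mem_support_iff.2 h2))
        exact absurd h3 (not_lt.2 hj)
      rw [map_sub, map_smul, Finsupp.sub_apply, Finsupp.smul_apply, b'.repr_self,
        Finsupp.single_eq_of_ne hji.symm, smul_zero, sub_zero] at h1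
      exact h1
    have hdiag : b'.repr (L (b i)) i = c i := by
      have h1 : b'.repr (L (b i) - c i • b' i) i = 0 := by
        have := h i
        rw [Module.Basis.mem_span_image] at this
        by_contra h2
        have h3 := this (Finset.mem_coe.2 (Finsupp.mem_support_iff.2 h2))
        exact lt_irrefl (len i) h3
      rw [map_sub, map_smul, Finsupp.sub_apply, Finsupp.smul_apply, b'.repr_self,
        Finsupp.single_eq_same, smul_eq_mul, mul_one, sub_eq_zero] at h1
      exact h1
    have h4 : b'.repr (L v) i = b.repr v i * c i := by
      conv_lhs => rw [← b.linearCombination_repr v, Finsupp.linearCombination_apply, Finsupp.sum,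
        map_sum, map_sum, Finsupp.finsetSum_apply]
      rw [Finset.sum_eq_single i]
      · rw [map_smul, map_smul, Finsupp.smul_apply, hdiag, smul_eq_mul]
      · intro j hj hji
        rw [map_smul, map_smul, Finsupp.smul_apply, key j (hmax j hj) hji, smul_zero]
      · intro h5
        exact absurd hi h5
    rw [hv, map_zero, Finsupp.zero_apply] at h4
    exact mul_ne_zero (Finsupp.mem_support_iff.1 hi) (hc i) h4.symm
  · rw [← LinearMap.range_eq_top, eq_top_iff, ← b'.span_eq, Submodule.span_le]
    rintro _ ⟨i, rfl⟩
    -- By strong induction on length, the lower-order correction is already in the range, and the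
    -- nonzero diagonal entry can be divided out.
    have : ∀ m i, len i = m → b' i ∈ LinearMap.range L := by
      intro m
      induction m using Nat.strong_induction_on with
      | _ m ih =>
        intro i hi
        have h1 : Submodule.span K (b' '' {j | len j < len i}) ≤ LinearMap.range L := by
          rw [Submodule.span_le]
          rintro _ ⟨j, hj, rfl⟩
          exact ih (len j) (hi ▸ hj) j rfl
        have h2 := sub_mem (LinearMap.mem_range_self L (b i)) (h1 (h i))
        rw [sub_sub_cancel] at h2
        exact (Submodule.smul_mem_iff _ (hc i)).1 h2
    exact this _ i rfl

end Triangular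

/-! ### The rational algebra -/

/-- The basis `d_λ` of `F`. -/
def FH.basis : Module.Basis EvenPartition ℤ FH :=
  Module.Basis.ofRepr (LinearEquiv.refl ℤ (EvenPartition →₀ ℤ))

/-- The basis `1 ⊗ d_λ` of `ℚ ⊗ F`. -/
def ratBasis : Module.Basis EvenPartition ℚ (ℚ ⊗[ℤ] FH) := FH.basis.baseChange ℚ

theorem ratBasis_apply (lam : EvenPartition) : ratBasis lam = 1 ⊗ₜ[ℤ] FH.d lam :=
  Module.Basis.baseChange_apply ..

/-- The span of the `1 ⊗ d_λ` with fewer than `m` parts. -/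
def lowSpan (m : ℕ) : Submodule ℚ (ℚ ⊗[ℤ] FH) :=
  Submodule.span ℚ (ratBasis '' {nu | nu.length < m})

theorem ratBasis_mul (lam mu : EvenPartition) : ratBasis lam * ratBasis mu =
    ∑ p, (topConst lam mu (EvenPartition.ofPartition (m := lam.size + mu.size) p) : ℚ) •
      ratBasis (EvenPartition.ofPartition p) := by
  rw [ratBasis_apply, ratBasis_apply, Algebra.TensorProduct.tmul_mul_tmul, one_mul, FH.d_mul_d,
    FH.basisMul_eq, TensorProduct.tmul_sum]
  refine Finset.sum_congr rfl fun p _ => ?_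
  rw [ratBasis_apply, TensorProduct.tmul_smul, Int.cast_smul_eq_zsmul]

theorem ratBasis_mul_mem_lowSpan (lam mu : EvenPartition) :
    ratBasis lam * ratBasis mu ∈ lowSpan (lam.length + mu.length + 1) := by
  rw [ratBasis_mul]
  refine sum_mem fun p _ => ?_
  by_cases h : topConst lam mu (EvenPartition.ofPartition p) = 0
  · rw [h, Int.cast_zero, zero_smul]; exact zero_mem _
  · refine Submodule.smul_mem _ _ (Submodule.subset_span ⟨_, ?_, rfl⟩)
    exact Nat.lt_succ_of_le (length_le_of_topConst (EvenPartition.size_ofPartition p) h)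

theorem EvenPartition.length_onePart (k : ℕ) : (EvenPartition.onePart k).length = 1 := rfl

theorem onePart_mul_mem_lowSpan (k m : ℕ) {r : ℚ ⊗[ℤ] FH} (hr : r ∈ lowSpan m) :
    ratBasis (EvenPartition.onePart k) * r ∈ lowSpan (m + 1) := by
  induction hr using Submodule.span_induction with
  | mem r hr =>
    obtain ⟨nu, hnu, rfl⟩ := hr
    refine Submodule.span_mono (Set.image_mono fun rho hrho => ?_)
      (ratBasis_mul_mem_lowSpan (EvenPartition.onePart k) nu)
    have h1 : nu.length < m := hnu
    have h2 : rho.length < (EvenPartition.onePart k).length + nu.length + 1 := hrho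
    rw [EvenPartition.length_onePart] at h2
    show rho.length < m + 1
    omega
  | zero => rw [mul_zero]; exact zero_mem _
  | add a b _ _ ha hb => rw [mul_add]; exact add_mem ha hb
  | smul c a _ ha => rw [mul_smul_comm]; exact Submodule.smul_mem _ _ ha

/-- The partition with parts `2(k+1)` for `k` in a multiset. -/
def EvenPartition.ofMultiset (s : Multiset ℕ) : EvenPartition :=
  ⟨s.map fun k => 2 * (k + 1), fun p hp => by
    obtain ⟨k, _, rfl⟩ := Multiset.mem_map.1 hp
    exact ⟨by omega, even_two_mul _⟩⟩

theorem EvenPartition.length_ofMultiset (s : Multiset ℕ) :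
    (EvenPartition.ofMultiset s).length = Multiset.card s := Multiset.card_map _ _

theorem EvenPartition.ofMultiset_bijective : Function.Bijective EvenPartition.ofMultiset := by
  constructor
  · intro s t h
    exact Multiset.map_injective (fun a b hab => by simpa using hab) (congrArg Subtype.val h)
  · intro lam
    refine ⟨lam.1.map fun p => p / 2 - 1, Subtype.ext ?_⟩
    change Multiset.map _ (Multiset.map _ _) = _
    rw [Multiset.map_map]
    conv_rhs => rw [← Multiset.map_id lam.1]
    refine Multiset.map_congr rfl fun p hp => ?_
    obtain ⟨h1, m, rfl⟩ := lam.2 p hp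
    simp only [Function.comp_apply, id]
    omega

/-- Among the terms of the product only the union of the two partitions attains the maximal length;
the others fall into the lower span. -/
theorem onePart_mul_ofMultiset (k : ℕ) (s : Multiset ℕ) : ∃ c : ℚ, c ≠ 0 ∧
    ratBasis (EvenPartition.onePart k) * ratBasis (EvenPartition.ofMultiset s) -
      c • ratBasis (EvenPartition.ofMultiset (k ::ₘ s)) ∈ lowSpan (Multiset.card s + 1) := by
  classical
  set lam := EvenPartition.onePart k
  set mu := EvenPartition.ofMultiset s
  set nu := EvenPartition.ofMultiset (k ::ₘ s)
  have hnu : nu.1 = lam.1 + mu.1 := Multiset.map_cons _ _ _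
  have hs : nu.size = lam.size + mu.size := by
    rw [EvenPartition.size, hnu, Multiset.sum_add]; rfl
  have hl : nu.length = lam.length + mu.length := by
    rw [EvenPartition.length, hnu, Multiset.card_add]; rfl
  have hl' : nu.length = Multiset.card s + 1 := by
    rw [EvenPartition.length_ofMultiset, Multiset.card_cons]
  refine ⟨topConst lam mu nu, Int.cast_ne_zero.2 (topConst_onePart_ne_zero k mu nu hnu), ?_⟩
  rw [ratBasis_mul, ← Finset.add_sum_erase _ _ (Finset.mem_univ (nu.toPartition hs)),
    EvenPartition.ofPartition_toPartition, add_sub_cancel_left]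
  refine sum_mem fun p hp => ?_
  by_cases h : topConst lam mu (EvenPartition.ofPartition p) = 0
  · rw [h, Int.cast_zero, zero_smul]; exact zero_mem _
  · refine Submodule.smul_mem _ _ (Submodule.subset_span ⟨_, ?_, rfl⟩)
    change (EvenPartition.ofPartition p).length < _
    rw [← hl']
    by_contra hge
    have h1 := eq_add_of_topConst (EvenPartition.size_ofPartition p) h (by omega)
    refine Finset.ne_of_mem_erase hp (EvenPartition.ofPartition_injective ?_)
    rw [EvenPartition.ofPartition_toPartition]
    exact Subtype.ext (h1.trans hnu.symm)

/-- The homomorphism from the polynomial ring sending `X_k` to the class of `2k+2`. -/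
def polyHom : MvPolynomial ℕ ℚ →ₐ[ℚ] ℚ ⊗[ℤ] FH :=
  MvPolynomial.aeval fun k => ratBasis (EvenPartition.onePart k)

theorem polyHom_X (k : ℕ) :
    polyHom (MvPolynomial.X k) = 1 ⊗ₜ[ℤ] FH.d (EvenPartition.onePart k) :=
  (MvPolynomial.aeval_X _ k).trans (ratBasis_apply _)

/-- Multiplication by a one-part class raises length by at most one, so lower-order errors stay of
lower order while the leading coefficients multiply. -/
theorem prod_onePart (s : Multiset ℕ) : ∃ c : ℚ, c ≠ 0 ∧
    (s.map fun k => ratBasis (EvenPartition.onePart k)).prod -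
      c • ratBasis (EvenPartition.ofMultiset s) ∈ lowSpan (Multiset.card s) := by
  induction s using Multiset.induction with
  | empty =>
    refine ⟨1, one_ne_zero, ?_⟩
    have e : ratBasis (EvenPartition.ofMultiset 0) = 1 := ratBasis_apply _
    rw [e, Multiset.map_zero, Multiset.prod_zero, one_smul, sub_self]
    exact zero_mem _
  | cons k s ih =>
    obtain ⟨c, hc, h⟩ := ih
    obtain ⟨c', hc', h'⟩ := onePart_mul_ofMultiset k s
    refine ⟨c * c', mul_ne_zero hc hc', ?_⟩
    have h1 := onePart_mul_mem_lowSpan k _ h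
    have h2 := add_mem h1 (Submodule.smul_mem _ c h')
    rw [Multiset.map_cons, Multiset.prod_cons, Multiset.card_cons]
    convert h2 using 1
    rw [mul_sub, mul_smul_comm, smul_sub, smul_smul, sub_add_sub_cancel]

/-- Monomials in `X_0, X_1, …` are indexed by even partitions. -/
def monomialIndex : (ℕ →₀ ℕ) ≃ EvenPartition :=
  Finsupp.orderIsoMultiset.toEquiv.trans (Equiv.ofBijective _ EvenPartition.ofMultiset_bijective)

theorem monomialIndex_apply (m : ℕ →₀ ℕ) :
    monomialIndex m = EvenPartition.ofMultiset (Finsupp.toMultiset m) := rfl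

theorem polyHom_monomial (m : ℕ →₀ ℕ) : polyHom (MvPolynomial.monomial m 1) =
    ((Finsupp.toMultiset m).map fun k => ratBasis (EvenPartition.onePart k)).prod := by
  rw [polyHom, MvPolynomial.aeval_monomial, map_one, one_mul, Finsupp.toMultiset_map,
    Finsupp.prod_toMultiset]
  rw [Finsupp.prod_mapDomain_index (by simp) (by intros; rw [pow_add])]

theorem polyHom_bijective : Function.Bijective polyHom := by
  choose c hc h using prod_onePart
  refine bijective_of_triangular
    ((MvPolynomial.basisMonomials ℕ ℚ).reindex monomialIndex) ratBasis EvenPartition.length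
    polyHom.toLinearMap (fun i => c (Finsupp.toMultiset (monomialIndex.symm i)))
    (fun i => hc _) fun i => ?_
  obtain ⟨m, rfl⟩ := monomialIndex.surjective i
  rw [Module.Basis.reindex_apply, Equiv.symm_apply_apply, MvPolynomial.coe_basisMonomials,
    AlgHom.toLinearMap_apply, polyHom_monomial, monomialIndex_apply,
    EvenPartition.length_ofMultiset]
  exact h _

end SpinFH

end

theorem mainTheorem7 :
    -- the structure constants and the top coefficients are well defined
    (∀ (n : ℕ) (lam mu : SpinFH.EvenPartition), ∃! c : SpinFH.EvenPartition →₀ ℤ,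
      SpinFH.IsExpansion n lam mu c) ∧
    (∀ lam mu nu : SpinFH.EvenPartition, nu.size = lam.size + mu.size →
      ∀ n : ℕ, nu.size + nu.length ≤ n →
        SpinFH.structConst n lam mu nu = SpinFH.topConst lam mu nu) ∧
    -- the product on `F` is commutative and associative, with unit `d_∅`
    (∀ a b : SpinFH.FH, a * b = b * a) ∧
    (∀ a b c : SpinFH.FH, a * b * c = a * (b * c)) ∧
    (∀ a : SpinFH.FH, SpinFH.FH.d SpinFH.EvenPartition.empty * a = a) ∧
    -- `ℚ ⊗ F` is a polynomial algebra on the `d_m`, `m = 2, 4, 6, …`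
    ∃ e : MvPolynomial ℕ ℚ ≃ₗ[ℚ] ℚ ⊗[ℤ] SpinFH.FH,
      (∀ p q : MvPolynomial ℕ ℚ, e (p * q) = e p * e q) ∧
      e 1 = 1 ⊗ₜ[ℤ] SpinFH.FH.d SpinFH.EvenPartition.empty ∧
      ∀ k : ℕ, e (MvPolynomial.X k) =
        1 ⊗ₜ[ℤ] SpinFH.FH.d (SpinFH.EvenPartition.onePart k) := by
  -- The product in the statement comes from the nonassociative ring structure, which `FH.commRing`
  -- extends, so multiplicativity of `polyHom` applies definitionally.
  refine ⟨SpinFH.existsUnique_isExpansion, fun _ _ _ hs _ hn => SpinFH.structConst_eq_topConst hs hn,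
    SpinFH.FH.mul_comm', SpinFH.FH.mul_assoc', SpinFH.FH.one_mul',
    LinearEquiv.ofBijective SpinFH.polyHom.toLinearMap SpinFH.polyHom_bijective,
    fun p q => map_mul SpinFH.polyHom p q, map_one SpinFH.polyHom, SpinFH.polyHom_X⟩
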